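/- **Pólya–Eggenberger-like walk with component-wise exponential displacements.** Let $c\ge 1$ and let $X(t)=(X_1(t),\dots,X_c(t))$, $t\ge 0$, be the continuum Pólya-like random walk in $\mathbb{R}^c$ started at a deterministic point $X(0)=(x_1,\dots,x_c)\neq 0$ with all $x_i\ge 0$, whose navigation matrix is diagonal with independent $\mathrm{Exp}(1)$ random diagonal entries $A_1,\dots,A_c$. That is: given the history up to a renewal (or up to time $0$) at which the walk is at $Y$, the waiting time until the next renewal is exponential with rate $\sum_k Y_k$, the type of that renewal is $j$ with probability $Y_j/\sum_k Y_k$, a fresh copy of the navigation matrix, independent of the history, is drawn, and these three are independent; if the type is $j$, then $A_j$ is added to the $j$-th coordinate. Let $W$ be the principal real branch of Lambert's function on $[-1/e,\infty)$ (the inverse of $w\mapsto we^w$ on $[-1,\infty)$), and let $T(z)=-W(-z)$, $z\le 1/e$, be the tree function. 1. For all $i$, all $t\ge 0$ and all real $u<1$ with $u e^{t-u}\le 1/e$, the variable $e^{uX_i(t)}$ is integrable and $$\mathbb{E}\,e^{uX_i(t)}=\exp\bigl(-x_i\,W(-u e^{t-u})\bigr).$$ 2. For all $i$ and all real $s\le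 1/e$, $s\ne 0$, $$\lim_{t\to\infty}\mathbb{E}\exp\bigl(s e^{-t}X_i(t)\bigr)=\Bigl(\frac{T(s)}{s}\Bigr)^{x_i}.$$ 3. For every $i$ there is a probability law on $\mathbb{R}$ whose moment generating function is $(T(s)/s)^{x_i}$ for all $s\le 1/e$, $s\neq 0$. If $W_1^*,\dots,W_c^*$ are independent random variables such that $W_i^*$ has this moment generating function for each $i$, then $e^{-t}X(t)$ converges in distribution to $(W_1^*,\dots,W_c^*)$ as $t\to\infty$. In particular, if $x_i=1$ for all $i$, then $\mathbb{E}\,e^{uX_i(t)}=e^{-W(-ue^{t-u})}$, and the limit is a vector of independent Lambert random variables, each with moment generating function $T(s)/s$. -/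

import Mathlib

open MeasureTheory ProbabilityTheory Filter Topology

noncomputable section

/-- Real matrices carry the product σ-algebra of their entries. -/
instance matrixMeasurableSpace (c : ℕ) : MeasurableSpace (Matrix (Fin c) (Fin c) ℝ) :=
  inferInstanceAs (MeasurableSpace (Fin c → Fin c → ℝ))

/-- The position in `ℝ^c` after `n` renewals of a walk that starts at `x`: the `n`-th renewal
(counted from `0`) has type `colour n`, and the walk moves by the row of that type of the
navigation matrix `nav n` in force at that renewal. -/
def positionAfter {Ω : Type*} {c : ℕ} (x : Fin c → ℝ) (colour : ℕ → Ω → Fin c)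
    (nav : ℕ → Ω → Matrix (Fin c) (Fin c) ℝ) : ℕ → Ω → Fin c → ℝ
  | 0, _ => x
  | n + 1, ω => fun j => positionAfter x colour nav n ω j + nav n ω (colour n ω) j

/-- A continuum Pólya-like random walk on the probability space `(Ω, P)`, with starting point `x`
and with a random navigation matrix of law `ν`, drawn afresh at each renewal.

Given the history up to the `n`-th renewal, at which the position is `Y`, the next waiting time
is exponential with rate `∑ k, Y k`, the type of the next renewal is `j` with probability
`Y j / ∑ k, Y k`, the navigation matrix used has law `ν`, and these three are independent. -/
structure ContinuumPolyaWalk {Ω : Type*} [mΩ : MeasurableSpace Ω] (P : Measure Ω) {c : ℕ}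
    (ν : Measure (Matrix (Fin c) (Fin c) ℝ)) (x : Fin c → ℝ) where
  /-- the waiting time between the `n`-th renewal (time `0` if `n = 0`) and the next one -/
  wait : ℕ → Ω → ℝ
  /-- the type of the renewal that ends the waiting time `wait n` -/
  colour : ℕ → Ω → Fin c
  /-- the navigation matrix used at that renewal -/
  nav : ℕ → Ω → Matrix (Fin c) (Fin c) ℝ
  /-- the information available after `n` renewals -/
  history : Filtration ℕ mΩ
  measurable_wait : ∀ n, Measurable[history (n + 1)] (wait n)
  measurable_colour : ∀ n, Measurable[history (n + 1)] (colour n)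
  measurable_nav : ∀ n, Measurable[history (n + 1)] (nav n)
  cond_law : ∀ (n : ℕ) (a : ℝ), 0 ≤ a → ∀ (j : Fin c) (B : Set (Matrix (Fin c) (Fin c) ℝ)),
    MeasurableSet B →
      P⟦{ω | a < wait n ω ∧ colour n ω = j ∧ nav n ω ∈ B} | history n⟧ =ᵐ[P] fun ω =>
        Real.exp (-(a * ∑ k, positionAfter x colour nav n ω k)) *
          (positionAfter x colour nav n ω j / ∑ k, positionAfter x colour nav n ω k) * ν.real B

namespace ContinuumPolyaWalk

variable {Ω : Type*} [MeasurableSpace Ω] {P : Measure Ω} {c : ℕ}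
  {ν : Measure (Matrix (Fin c) (Fin c) ℝ)} {x : Fin c → ℝ}

/-- The time of the `n`-th renewal; `renewalTime 0 = 0`. -/
def renewalTime (w : ContinuumPolyaWalk P ν x) (n : ℕ) (ω : Ω) : ℝ :=
  ∑ k ∈ Finset.range n, w.wait k ω

/-- The number of renewals in the time interval `(0, t]`. -/
def renewalCount (w : ContinuumPolyaWalk P ν x) (t : ℝ) (ω : Ω) : ℕ :=
  Set.ncard {n : ℕ | w.renewalTime (n + 1) ω ≤ t}

/-- The position `X(t)` of the walk at time `t`. -/
def X (w : ContinuumPolyaWalk P ν x) (t : ℝ) (ω : Ω) : Fin c → ℝ :=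
  positionAfter x w.colour w.nav (w.renewalCount t ω) ω

end ContinuumPolyaWalk

/-- The law of a diagonal random matrix with independent `Exp(1)` diagonal entries. -/
def expDiagonalLaw (c : ℕ) : Measure (Matrix (Fin c) (Fin c) ℝ) :=
  (Measure.pi fun _ : Fin c => expMeasure 1).map fun a => Matrix.diagonal a

theorem measurable_diagonal (c : ℕ) :
    Measurable fun a : Fin c → ℝ => (Matrix.diagonal a : Matrix (Fin c) (Fin c) ℝ) := by
  refine measurable_pi_lambda _ fun i => measurable_pi_lambda _ fun j => ?_
  by_cases h : i = j
  · subst h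
    simpa using measurable_pi_apply i
  · simp [Matrix.diagonal_apply_ne _ h]

/-- The principal branch of Lambert's `W` function on `[-1/e, ∞)`: the inverse of `w ↦ w * e ^ w`
on `[-1, ∞)`. -/
def lambertW (z : ℝ) : ℝ :=
  Function.invFunOn (fun w : ℝ => w * Real.exp w) (Set.Ici (-1)) z

/-- The tree function `T(z) = -W(-z)`, for `z ≤ 1/e`. -/
def treeFunction (z : ℝ) : ℝ := -lambertW (-z)

/-- `Z` is a Lambert random variable with parameter `r`: its moment generating function is
`(T(s)/s) ^ r` for `s ≤ 1/e` (the value at `s = 0`, by continuity, is `1` and carries no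
information). The Lambert random variable is the case `r = 1`. -/
def IsLambert {Ω : Type*} [MeasurableSpace Ω] (Z : Ω → ℝ) (P : Measure Ω) (r : ℝ) : Prop :=
  AEMeasurable Z P ∧ ∀ s : ℝ, s ≤ Real.exp (-1) → s ≠ 0 →
    Integrable (fun ω => Real.exp (s * Z ω)) P ∧ mgf Z P s = (treeFunction s / s) ^ r

end

open scoped NNReal BoundedContinuousFunction

/-! Let each `v i` solve `v' = v / (1 - v)`. From position `y`, a renewal of type `j` occurs at rate
`y j` and multiplies `exp (y · v)` by `1 / (1 - v j)` on average. Since `1 / (1 - v) - 1 = v'`,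
gains and losses balance: `exp (y · v (t - r))`, as a function of position and time `r`, is
preserved in mean by the walk. Hence `E exp (X t · v 0) = exp (x · v t)`. The equations decouple, so
the joint transform is a product over coordinates; and `v * exp (-v)` grows like `exp t`, so `v t =
-W (-u * exp (t - u))` when `v 0 = u`.

The balance for one renewal is `lintegral_flow_step`. Iterating it (`sum_exactTerm_add_beforeTerm`)
gives the sum over paths with fewer than `n` renewals up to `t`, plus a remainder carried by paths
with at least `n`. The remainder vanishes (`tendsto_beforeTerm`): a slightly larger flow dominates
it at large positions, and `E exp (-|Y n|) = 2 ^ (-n) * exp (-|x|)`, with `Y n` the position after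
`n` renewals, handles bounded ones. Taking `u = 0` excludes explosion. The boundary case `u * exp (t
- u) = 1/e` follows by monotone convergence in `u`.

With `u = s * exp (-t)` the argument of `W` tends to `-s`, and `T s / s = exp (T s)` gives the limit
in the required form. Exponential moments at `1/e` are bounded uniformly in `t ≥ 0`, so the rescaled
laws are tight. A limit point has the Lambert transform, endpoint included
(`integrable_and_integral_exp_of_tendsto`), which proves existence. Laplace transforms at integer
points separate laws on the orthant, and their product limit gives convergence to independent
coordinates (`tendsto_of_tight_of_tendsto_laplace`). -/

/-! ### Integration against the conditional law of one renewal. -/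

theorem lintegral_Ioi_rate {q S a : ℝ} (hq : 0 ≤ q) (hS : 0 < S) :
    ∫⁻ s in Set.Ioi a, ENNReal.ofReal (q * Real.exp (-(s * S))) =
      ENNReal.ofReal (Real.exp (-(a * S)) * (q / S)) := by
  have hint : IntegrableOn (fun s : ℝ => q * Real.exp (-(s * S))) (Set.Ioi a) := by
    have := (exp_neg_integrableOn_Ioi a hS).const_mul q
    refine this.congr (ae_of_all _ fun s => ?_)
    simp only; ring_nf
  rw [← ofReal_integral_eq_lintegral_ofReal hint
    (ae_of_all _ fun s => mul_nonneg hq (Real.exp_pos _).le)]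
  congr 1
  have h := integral_exp_mul_Ioi (neg_lt_zero.mpr hS) a
  have : (fun s : ℝ => q * Real.exp (-(s * S))) = fun s => q * Real.exp (-S * s) := by
    ext s; ring_nf
  rw [this, integral_const_mul, h]
  have : -S * a = -(a * S) := by ring
  rw [this]
  field_simp

/-- Integration against the joint law of the past `h`, a waiting time `τ` with exponential rate
`S`, and an independent mark with law `ν`, on an event `E` of conditional probability `q / S`. -/
theorem setLIntegral_eq_of_cond_law {Ω H M : Type*} {m mΩ : MeasurableSpace Ω}
    [MeasurableSpace H] [MeasurableSpace M] {P : Measure Ω} [IsProbabilityMeasure P]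
    (hm : m ≤ mΩ) {h : Ω → H} (hh : Measurable[m] h) {τ : Ω → ℝ} (hτ : Measurable τ)
    {E : Set Ω} (hE : MeasurableSet E) {nav : Ω → M} (hnav : Measurable nav)
    {ν : Measure M} [IsProbabilityMeasure ν] {q S : H → ℝ} (hq : Measurable q) (hS : Measurable S)
    (hq0 : ∀ᵐ ω ∂P, 0 ≤ q (h ω)) (hS0 : ∀ᵐ ω ∂P, 0 < S (h ω)) (hτ0 : ∀ᵐ ω ∂P, 0 < τ ω)
    (hc : ∀ a : ℝ, 0 ≤ a → ∀ B : Set M, MeasurableSet B →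
      P⟦{ω | a < τ ω ∧ ω ∈ E ∧ nav ω ∈ B} | m⟧ =ᵐ[P] fun ω =>
        Real.exp (-(a * S (h ω))) * (q (h ω) / S (h ω)) * ν.real B)
    {F : H → ℝ → M → ENNReal} (hF : Measurable fun p : H × ℝ × M => F p.1 p.2.1 p.2.2) :
    ∫⁻ ω in E, F (h ω) (τ ω) (nav ω) ∂P =
      ∫⁻ ω, (∫⁻ s in Set.Ioi 0, ENNReal.ofReal (q (h ω) * Real.exp (-(s * S (h ω)))) *
        ∫⁻ B, F (h ω) s B ∂ν) ∂P := by
  have hh' : Measurable h := hh.mono hm le_rfl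
  have htriple : Measurable fun ω => (h ω, τ ω, nav ω) := by fun_prop
  -- The claim is an equality of two measures on triples (past, waiting time, mark): the actual law
  -- on `E`, and the law with the explicit density.
  set μ₁ : Measure (H × ℝ × M) := (P.restrict E).map fun ω => (h ω, τ ω, nav ω) with hμ₁
  set g : H × ℝ × M → ENNReal :=
    fun p => ENNReal.ofReal (q p.1 * Real.exp (-(p.2.1 * S p.1))) with hg
  have hgm : Measurable g := by fun_prop
  have hPh : IsProbabilityMeasure (P.map h) := Measure.isProbabilityMeasure_map hh'.aemeasurable
  set μ₂ : Measure (H × ℝ × M) :=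
    ((P.map h).prod ((volume.restrict (Set.Ioi (0 : ℝ))).prod ν)).withDensity g with hμ₂
  have hfin : IsFiniteMeasure μ₁ := by rw [hμ₁]; infer_instance
  have hint₂ : ∀ G : H × ℝ × M → ENNReal, Measurable G → ∫⁻ p, G p ∂μ₂ =
      ∫⁻ ω, (∫⁻ s in Set.Ioi 0, ENNReal.ofReal (q (h ω) * Real.exp (-(s * S (h ω)))) *
        ∫⁻ B, G (h ω, s, B) ∂ν) ∂P := by
    intro G hG
    rw [hμ₂, lintegral_withDensity_eq_lintegral_mul _ hgm hG,
      lintegral_prod _ (hgm.mul hG).aemeasurable, lintegral_map (by fun_prop) hh']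
    refine lintegral_congr fun ω => ?_
    rw [lintegral_prod _ (by fun_prop)]
    refine lintegral_congr fun s => ?_
    simp only [Pi.mul_apply, hg]
    rw [lintegral_const_mul _ (by fun_prop)]
  have hrect₂ : ∀ (A : Set H) (I : Set ℝ) (B : Set M), MeasurableSet A → MeasurableSet I →
      MeasurableSet B → μ₂ (A ×ˢ I ×ˢ B) = ∫⁻ ω in h ⁻¹' A, (∫⁻ s in I ∩ Set.Ioi 0,
        ENNReal.ofReal (q (h ω) * Real.exp (-(s * S (h ω))))) * ν B ∂P := by
    intro A I B hA hI hB
    rw [← lintegral_indicator_one (hA.prod (hI.prod hB)),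
      hint₂ _ (measurable_one.indicator (hA.prod (hI.prod hB))),
      ← lintegral_indicator (hh' hA)]
    refine lintegral_congr fun ω => ?_
    by_cases hω : h ω ∈ A
    · rw [Set.indicator_of_mem (by exact hω), ← lintegral_mul_const _ (by fun_prop),
        ← Measure.restrict_restrict hI, ← lintegral_indicator hI]
      refine lintegral_congr fun s => ?_
      by_cases hs : s ∈ I
      · rw [Set.indicator_of_mem hs]
        congr 1
        rw [← lintegral_indicator_one hB]
        refine lintegral_congr fun b => ?_
        by_cases hb : b ∈ B <;> simp [Set.indicator, hω, hs, hb]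
      · simp [Set.indicator, hs]
    · rw [Set.indicator_of_notMem (by exact hω)]
      simp [Set.indicator, hω]
  have hrect₁ : ∀ (A : Set H) (I : Set ℝ) (B : Set M), MeasurableSet A → MeasurableSet I →
      MeasurableSet B →
      μ₁ (A ×ˢ I ×ˢ B) = P ({ω | τ ω ∈ I ∧ ω ∈ E ∧ nav ω ∈ B} ∩ h ⁻¹' A) := by
    intro A I B hA hI hB
    rw [hμ₁, Measure.map_apply htriple (hA.prod (hI.prod hB)),
      Measure.restrict_apply (htriple (hA.prod (hI.prod hB)))]
    congr 1
    ext ω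
    simp only [Set.mem_inter_iff, Set.mem_preimage, Set.mem_prod, Set.mem_ofPred_eq]
    tauto
  -- The conditional law gives agreement on `A × (a, ∞) × B` for `a ≥ 0`; the half-line `(-∞, 0]` is
  -- null for both measures.
  have hIoi : ∀ (A : Set H) (a : ℝ) (B : Set M), MeasurableSet A → 0 ≤ a →
      MeasurableSet B → μ₁ (A ×ˢ Set.Ioi a ×ˢ B) = μ₂ (A ×ˢ Set.Ioi a ×ˢ B) := by
    intro A a B hA ha hB
    rw [hrect₁ A _ B hA measurableSet_Ioi hB, hrect₂ A _ B hA measurableSet_Ioi hB]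
    have hD : MeasurableSet {ω | a < τ ω ∧ ω ∈ E ∧ nav ω ∈ B} :=
      (measurableSet_lt measurable_const hτ).inter (hE.inter (hnav hB))
    set D := {ω | a < τ ω ∧ ω ∈ E ∧ nav ω ∈ B} with hDdef
    have hDint : Integrable (D.indicator fun _ => (1 : ℝ)) P :=
      (integrable_const 1).indicator hD
    have h1 := setIntegral_condExp hm hDint (hh hA)
    rw [setIntegral_congr_ae (hm _ (hh hA)) ((hc a ha B hB).mono fun ω hω _ => hω)] at h1
    have h2 : ∫ ω in h ⁻¹' A, D.indicator (fun _ => (1 : ℝ)) ω ∂P = P.real (D ∩ h ⁻¹' A) := by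
      rw [integral_indicator_const (1 : ℝ) hD, measureReal_restrict_apply hD]
      simp
    rw [h2] at h1
    change P (D ∩ h ⁻¹' A) = _
    rw [← ofReal_measureReal (measure_ne_top _ _), ← h1, ofReal_integral_eq_lintegral_ofReal]
    · refine lintegral_congr_ae (ae_restrict_of_ae ?_)
      filter_upwards [hq0, hS0] with ω hq0 hS0
      rw [Set.inter_eq_left.mpr (Set.Ioi_subset_Ioi ha), lintegral_Ioi_rate hq0 hS0,
        ENNReal.ofReal_mul (by positivity), ofReal_measureReal (measure_ne_top _ _)]
    · exact (integrable_condExp.congr (hc a ha B hB)).integrableOn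
    · refine ae_restrict_of_ae ?_
      filter_upwards [hq0, hS0] with ω hq0 hS0
      simp only [Pi.zero_apply]
      positivity
  have hzero : ∀ (A : Set H) (B : Set M), MeasurableSet A → MeasurableSet B →
      μ₁ (A ×ˢ Set.Iic 0 ×ˢ B) = 0 ∧ μ₂ (A ×ˢ Set.Iic 0 ×ˢ B) = 0 := by
    intro A B hA hB
    constructor
    · rw [hrect₁ A _ B hA measurableSet_Iic hB]
      refine measure_mono_null (t := {ω | ¬ 0 < τ ω}) ?_ hτ0
      rintro ω ⟨⟨h1, -⟩, -⟩
      exact not_lt.mpr h1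
    · rw [hrect₂ A _ B hA measurableSet_Iic hB]
      have : Set.Iic (0 : ℝ) ∩ Set.Ioi 0 = ∅ := by ext; simp
      simp [this]
  have hμ : μ₁ = μ₂ := by
    -- For fixed `A` and `B` these are finite measures on the line, determined by the sets `Iic a`;
    -- such values are recovered from those on `Ioi a` by subtraction.
    refine Measure.ext_prod₃ fun {A I B} hA hI hB => ?_
    have hpr : Measurable fun p : H × ℝ × M => p.2.1 := by fun_prop
    have hr : ∀ (μ : Measure (H × ℝ × M)) (J : Set ℝ), MeasurableSet J →
        ((μ.restrict (A ×ˢ Set.univ ×ˢ B)).map fun p => p.2.1) J = μ (A ×ˢ J ×ˢ B) := by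
      intro μ J hJ
      rw [Measure.map_apply hpr hJ, Measure.restrict_apply (hpr hJ)]
      congr 1
      ext p
      simp only [Set.mem_inter_iff, Set.mem_preimage, Set.mem_prod, Set.mem_univ, true_and]
      tauto
    rw [← hr μ₁ I hI, ← hr μ₂ I hI]
    congr 1
    refine Measure.ext_of_Iic _ _ fun a => ?_
    rw [hr _ _ measurableSet_Iic, hr _ _ measurableSet_Iic]
    rcases le_total a 0 with ha | ha
    · have hsub : A ×ˢ Set.Iic a ×ˢ B ⊆ A ×ˢ Set.Iic 0 ×ˢ B :=
        Set.prod_mono_right (Set.prod_mono_left (Set.Iic_subset_Iic.mpr ha))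
      rw [measure_mono_null hsub (hzero A B hA hB).1, measure_mono_null hsub (hzero A B hA hB).2]
    · have hsplit : ∀ μ : Measure (H × ℝ × M), μ (A ×ˢ Set.Iic 0 ×ˢ B) = 0 →
          μ (A ×ˢ Set.Iic a ×ˢ B) + μ (A ×ˢ Set.Ioi a ×ˢ B) = μ (A ×ˢ Set.Ioi 0 ×ˢ B) := by
        intro μ h0
        rw [← hr μ _ measurableSet_Iic] at h0
        rw [← hr μ _ measurableSet_Iic, ← hr μ _ measurableSet_Ioi, ← hr μ _ measurableSet_Ioi,
          ← measure_union (Set.Iic_disjoint_Ioi le_rfl) measurableSet_Ioi, Set.Iic_union_Ioi]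
        nth_rewrite 2 [← Set.Iic_union_Ioi (a := (0 : ℝ))]
        rw [measure_union (Set.Iic_disjoint_Ioi le_rfl) measurableSet_Ioi, h0, zero_add]
      have e1 := hsplit μ₁ (hzero A B hA hB).1
      have e2 := hsplit μ₂ (hzero A B hA hB).2
      rw [← hIoi A a B hA ha hB, ← hIoi A 0 B hA le_rfl hB, ← e1] at e2
      exact (ENNReal.add_left_inj (measure_ne_top _ _)).mp e2.symm
  rw [← hint₂ (fun p => F p.1 p.2.1 p.2.2) hF, ← hμ, hμ₁, lintegral_map hF htriple]

/-! ### Measurability, positivity and the one-step formula for the walk. -/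

instance isProbabilityMeasure_expMeasure_one : IsProbabilityMeasure (expMeasure 1) :=
  isProbabilityMeasure_expMeasure one_pos

instance isProbabilityMeasure_expDiagonalLaw (c : ℕ) :
    IsProbabilityMeasure (expDiagonalLaw c) :=
  Measure.isProbabilityMeasure_map (measurable_diagonal c).aemeasurable

theorem ae_nonneg_expMeasure : ∀ᵐ a ∂expMeasure 1, 0 ≤ a := by
  rw [ae_iff]
  have : {a : ℝ | ¬ 0 ≤ a} = Set.Iio 0 := by ext; simp
  rw [this, expMeasure, gammaMeasure, withDensity_apply _ measurableSet_Iio]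
  exact lintegral_exponentialPDF_of_nonpos le_rfl

theorem measurable_matrix_entry {c : ℕ} (i j : Fin c) :
    Measurable fun B : Matrix (Fin c) (Fin c) ℝ => B i j :=
  (measurable_pi_apply j).comp (measurable_pi_apply i)

theorem ae_nonneg_expDiagonalLaw (c : ℕ) : ∀ᵐ B ∂expDiagonalLaw c, ∀ i j, 0 ≤ B i j := by
  have hms : MeasurableSet {B : Matrix (Fin c) (Fin c) ℝ | ∀ i j, 0 ≤ B i j} := by
    simp only [Set.ofPred_forall]
    exact MeasurableSet.iInter fun i => MeasurableSet.iInter fun j =>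
      measurableSet_le measurable_const (measurable_matrix_entry i j)
  rw [expDiagonalLaw, ae_map_iff (measurable_diagonal c).aemeasurable hms]
  have h : ∀ i : Fin c, ∀ᵐ a ∂(Measure.pi fun _ : Fin c => expMeasure 1), 0 ≤ a i := fun i =>
    (Measure.quasiMeasurePreserving_eval (fun _ : Fin c => expMeasure 1) i).ae
      ae_nonneg_expMeasure
  filter_upwards [ae_all_iff.mpr h] with a ha i j
  by_cases hij : i = j
  · subst hij; simpa using ha i
  · simp [Matrix.diagonal_apply_ne _ hij]

namespace ContinuumPolyaWalk

variable {Ω : Type*} [MeasurableSpace Ω] {P : Measure Ω} {c : ℕ}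
  {ν : Measure (Matrix (Fin c) (Fin c) ℝ)} {x : Fin c → ℝ}

/-- The position after `n` renewals. -/
abbrev pos (w : ContinuumPolyaWalk P ν x) (n : ℕ) (ω : Ω) : Fin c → ℝ :=
  positionAfter x w.colour w.nav n ω

theorem pos_succ (w : ContinuumPolyaWalk P ν x) (n : ℕ) (ω : Ω) :
    w.pos (n + 1) ω = w.pos n ω + w.nav n ω (w.colour n ω) := rfl

theorem renewalTime_succ (w : ContinuumPolyaWalk P ν x) (n : ℕ) (ω : Ω) :
    w.renewalTime (n + 1) ω = w.renewalTime n ω + w.wait n ω :=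
  Finset.sum_range_succ _ _

theorem measurable_nav_colour (w : ContinuumPolyaWalk P ν x) (n : ℕ) :
    Measurable[w.history (n + 1)] fun ω => w.nav n ω (w.colour n ω) := by
  have h1 := w.measurable_nav n
  have h2 := w.measurable_colour n
  have : Measurable fun p : Fin c × Matrix (Fin c) (Fin c) ℝ => p.2 p.1 := by
    refine measurable_from_prod_countable_right fun i => ?_
    exact measurable_pi_apply i
  exact this.comp (h2.prodMk h1)

theorem measurable_pos_history (w : ContinuumPolyaWalk P ν x) (n : ℕ) :
    Measurable[w.history n] (w.pos n) := by
  induction n with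
  | zero => exact measurable_const
  | succ n ih =>
    have h := ih.mono (w.history.mono n.le_succ) le_rfl
    exact h.add (w.measurable_nav_colour n)

theorem measurable_renewalTime_history (w : ContinuumPolyaWalk P ν x) (n : ℕ) :
    Measurable[w.history n] (w.renewalTime n) := by
  refine Finset.measurable_fun_sum _ fun k hk => ?_
  exact (w.measurable_wait k).mono (w.history.mono (Finset.mem_range.mp hk)) le_rfl

theorem measurable_pos (w : ContinuumPolyaWalk P ν x) (n : ℕ) : Measurable (w.pos n) :=
  (w.measurable_pos_history n).mono (w.history.le n) le_rfl

theorem measurable_renewalTime (w : ContinuumPolyaWalk P ν x) (n : ℕ) :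
    Measurable (w.renewalTime n) :=
  (w.measurable_renewalTime_history n).mono (w.history.le n) le_rfl

theorem measurable_wait' (w : ContinuumPolyaWalk P ν x) (n : ℕ) : Measurable (w.wait n) :=
  (w.measurable_wait n).mono (w.history.le _) le_rfl

theorem measurable_colour' (w : ContinuumPolyaWalk P ν x) (n : ℕ) : Measurable (w.colour n) :=
  (w.measurable_colour n).mono (w.history.le _) le_rfl

theorem measurable_nav' (w : ContinuumPolyaWalk P ν x) (n : ℕ) : Measurable (w.nav n) :=
  (w.measurable_nav n).mono (w.history.le _) le_rfl

/-- The conditional law at `a = 0` is summed over the types, whose probabilities add up to `1`.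
Positivity of the waiting times is thereby derived from `cond_law`. -/
theorem measureReal_wait_pos_nav_mem [IsProbabilityMeasure P]
    (w : ContinuumPolyaWalk P ν x) (n : ℕ) (hS : ∀ᵐ ω ∂P, 0 < ∑ k, w.pos n ω k)
    {B : Set (Matrix (Fin c) (Fin c) ℝ)} (hB : MeasurableSet B) :
    P.real {ω | 0 < w.wait n ω ∧ w.nav n ω ∈ B} = ν.real B := by
  have hD : ∀ j, MeasurableSet {ω | 0 < w.wait n ω ∧ w.colour n ω = j ∧ w.nav n ω ∈ B} :=
    fun j => (measurableSet_lt measurable_const (w.measurable_wait' n)).inter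
      ((w.measurable_colour' n (measurableSet_singleton j)).inter (w.measurable_nav' n hB))
  have hj : ∀ j, Integrable (fun ω => (w.pos n ω j / ∑ k, w.pos n ω k) * ν.real B) P ∧
      P.real {ω | 0 < w.wait n ω ∧ w.colour n ω = j ∧ w.nav n ω ∈ B} =
      ∫ ω, (w.pos n ω j / ∑ k, w.pos n ω k) * ν.real B ∂P := by
    intro j
    have h := w.cond_law n 0 le_rfl j B hB
    simp only [zero_mul, neg_zero, Real.exp_zero, one_mul] at h
    refine ⟨integrable_condExp.congr h, ?_⟩
    rw [← integral_congr_ae h, integral_condExp (w.history.le n),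
      integral_indicator_const _ (hD j)]
    simp
  have hsum : P.real {ω | 0 < w.wait n ω ∧ w.nav n ω ∈ B} =
      ∑ j, P.real {ω | 0 < w.wait n ω ∧ w.colour n ω = j ∧ w.nav n ω ∈ B} := by
    rw [← measureReal_biUnion_finset]
    · congr 1
      ext ω
      simp
    · intro i _ j _ hij
      rw [Function.onFun, Set.disjoint_left]
      rintro ω ⟨-, h1, -⟩ ⟨-, h2, -⟩
      exact hij (h1.symm.trans h2)
    · exact fun j _ => hD j
  rw [hsum, Finset.sum_congr rfl fun j _ => (hj j).2,
    ← integral_finsetSum _ fun j _ => (hj j).1]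
  have : (fun ω => ∑ j, w.pos n ω j / (∑ k, w.pos n ω k) * ν.real B) =ᵐ[P]
      fun _ => ν.real B := by
    filter_upwards [hS] with ω hω
    rw [← Finset.sum_mul, ← Finset.sum_div, div_self hω.ne', one_mul]
  rw [integral_congr_ae this]
  simp

variable [IsProbabilityMeasure P]

theorem ae_wait_pos_nav_mem [IsProbabilityMeasure ν] (w : ContinuumPolyaWalk P ν x) (n : ℕ)
    (hS : ∀ᵐ ω ∂P, 0 < ∑ k, w.pos n ω k) {B : Set (Matrix (Fin c) (Fin c) ℝ)}
    (hB : MeasurableSet B) (hνB : ∀ᵐ b ∂ν, b ∈ B) :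
    ∀ᵐ ω ∂P, 0 < w.wait n ω ∧ w.nav n ω ∈ B := by
  have h := w.measureReal_wait_pos_nav_mem n hS hB
  have h1 : ν.real B = 1 := by
    rw [measureReal_def, (prob_compl_eq_zero_iff hB).mp hνB, ENNReal.toReal_one]
  have hm : MeasurableSet {ω | 0 < w.wait n ω ∧ w.nav n ω ∈ B} :=
    (measurableSet_lt measurable_const (w.measurable_wait' n)).inter (w.measurable_nav' n hB)
  rw [h1, measureReal_def, ENNReal.toReal_eq_one_iff] at h
  exact (prob_compl_eq_zero_iff hm).mpr h

/-- The induction must carry both claims: a positive total is needed to identify the law of the next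
matrix, and the nonnegative entries of that matrix preserve both. -/
theorem ae_pos_nonneg (w : ContinuumPolyaWalk P (expDiagonalLaw c) x) (hx : ∀ i, 0 ≤ x i)
    (hx0 : x ≠ 0) (n : ℕ) :
    ∀ᵐ ω ∂P, (∀ i, 0 ≤ w.pos n ω i) ∧ 0 < ∑ k, w.pos n ω k := by
  induction n with
  | zero =>
    refine ae_of_all _ fun ω => ⟨hx, ?_⟩
    obtain ⟨i, hi⟩ := Function.ne_iff.mp hx0
    exact Finset.sum_pos' (fun i _ => hx i)
      ⟨i, Finset.mem_univ _, lt_of_le_of_ne (hx i) (Ne.symm hi)⟩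
  | succ n ih =>
    have hB : MeasurableSet {B : Matrix (Fin c) (Fin c) ℝ | ∀ i j, 0 ≤ B i j} := by
      simp only [Set.ofPred_forall]
      exact MeasurableSet.iInter fun i => MeasurableSet.iInter fun j =>
        measurableSet_le measurable_const (measurable_matrix_entry i j)
    filter_upwards [ih, w.ae_wait_pos_nav_mem n (ih.mono fun _ h => h.2) hB
      (ae_nonneg_expDiagonalLaw c)] with ω h1 h2
    have h3 : ∀ i, w.pos n ω i ≤ w.pos (n + 1) ω i := fun i =>
      le_add_of_nonneg_right (h2.2 _ i)
    exact ⟨fun i => (h1.1 i).trans (h3 i), h1.2.trans_le (Finset.sum_le_sum fun i _ => h3 i)⟩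

theorem ae_wait_pos (w : ContinuumPolyaWalk P (expDiagonalLaw c) x) (hx : ∀ i, 0 ≤ x i)
    (hx0 : x ≠ 0) (n : ℕ) : ∀ᵐ ω ∂P, 0 < w.wait n ω :=
  (w.ae_wait_pos_nav_mem n ((w.ae_pos_nonneg hx hx0 n).mono fun _ h => h.2) MeasurableSet.univ
    (ae_of_all _ fun _ => Set.mem_univ _)).mono fun _ h => h.1

/-- One-step integration: the renewal after the `n`-th one, conditionally on the past. -/
theorem lintegral_step (w : ContinuumPolyaWalk P (expDiagonalLaw c) x) (hx : ∀ i, 0 ≤ x i)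
    (hx0 : x ≠ 0) (n : ℕ)
    {F : Fin c → ℝ × (Fin c → ℝ) → ℝ → Matrix (Fin c) (Fin c) ℝ → ENNReal}
    (hF : ∀ j, Measurable fun p : (ℝ × (Fin c → ℝ)) × ℝ × Matrix (Fin c) (Fin c) ℝ =>
      F j p.1 p.2.1 p.2.2) :
    ∫⁻ ω, F (w.colour n ω) (w.renewalTime n ω, w.pos n ω) (w.wait n ω) (w.nav n ω) ∂P =
      ∫⁻ ω, (∑ j, ∫⁻ s in Set.Ioi 0,
        ENNReal.ofReal (w.pos n ω j * Real.exp (-(s * ∑ k, w.pos n ω k))) *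
          ∫⁻ B, F j (w.renewalTime n ω, w.pos n ω) s B ∂expDiagonalLaw c) ∂P := by
  have hh : Measurable[w.history n] fun ω => (w.renewalTime n ω, w.pos n ω) :=
    (w.measurable_renewalTime_history n).prodMk (w.measurable_pos_history n)
  have hE : ∀ j, MeasurableSet (w.colour n ⁻¹' {j}) := fun j =>
    w.measurable_colour' n (measurableSet_singleton j)
  -- On each event `colour n = j` the type is constant, so the general formula applies with `q = Y
  -- j` and `S = ∑ k, Y k`.
  have key : ∀ j, ∫⁻ ω in w.colour n ⁻¹' {j},
      F (w.colour n ω) (w.renewalTime n ω, w.pos n ω) (w.wait n ω) (w.nav n ω) ∂P =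
      ∫⁻ ω, (∫⁻ s in Set.Ioi 0,
        ENNReal.ofReal (w.pos n ω j * Real.exp (-(s * ∑ k, w.pos n ω k))) *
          ∫⁻ B, F j (w.renewalTime n ω, w.pos n ω) s B ∂expDiagonalLaw c) ∂P := by
    intro j
    rw [setLIntegral_congr_fun (hE j)
      (g := fun ω => F j (w.renewalTime n ω, w.pos n ω) (w.wait n ω) (w.nav n ω))
      fun ω hω => by rw [Set.mem_preimage, Set.mem_singleton_iff] at hω; simp only [hω]]
    refine setLIntegral_eq_of_cond_law (w.history.le n) hh (w.measurable_wait' n) (hE j)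
      (w.measurable_nav' n) (q := fun h => h.2 j) (S := fun h => ∑ k, h.2 k)
      (by fun_prop) (by fun_prop)
      ((w.ae_pos_nonneg hx hx0 n).mono fun _ h => h.1 j)
      ((w.ae_pos_nonneg hx hx0 n).mono fun _ h => h.2) (w.ae_wait_pos hx hx0 n) ?_ (hF j)
    intro a ha B hB
    exact w.cond_law n a ha j B hB
  have hmeas : ∀ j, Measurable fun ω => ∫⁻ s in Set.Ioi 0,
        ENNReal.ofReal (w.pos n ω j * Real.exp (-(s * ∑ k, w.pos n ω k))) *
          ∫⁻ B, F j (w.renewalTime n ω, w.pos n ω) s B ∂expDiagonalLaw c := by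
    intro j
    have hh' : Measurable fun ω => (w.renewalTime n ω, w.pos n ω) := hh.mono (w.history.le n) le_rfl
    have h1 : Measurable fun p : (ℝ × (Fin c → ℝ)) × ℝ =>
        ENNReal.ofReal (p.1.2 j * Real.exp (-(p.2 * ∑ k, p.1.2 k))) *
          ∫⁻ B, F j p.1 p.2 B ∂expDiagonalLaw c := by
      refine Measurable.mul (by fun_prop) (Measurable.lintegral_prod_right ?_)
      exact (hF j).comp
        (by fun_prop : Measurable fun q : ((ℝ × (Fin c → ℝ)) × ℝ) × Matrix (Fin c) (Fin c) ℝ =>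
          (q.1.1, q.1.2, q.2))
    exact (h1.lintegral_prod_right' (ν := volume.restrict (Set.Ioi 0))).comp hh'
  rw [lintegral_finsetSum _ fun j _ => hmeas j, ← Finset.sum_congr rfl fun j _ => key j,
    ← lintegral_biUnion_finset (fun i _ j _ hij => ?_) (fun j _ => hE j)]
  · have : ⋃ j ∈ (Finset.univ : Finset (Fin c)), w.colour n ⁻¹' {j} = Set.univ := by
      ext; simp
    rw [this, Measure.restrict_univ]
  · exact Disjoint.preimage _ (Set.disjoint_singleton.mpr hij)

end ContinuumPolyaWalk

/-! ### The exponential flow and the balance over one renewal. -/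

/-- Exponential tilting turns the `Exp(1)` density into `1 / (1 - v)` times the `Exp(1 - v)`
density. -/
theorem lintegral_exp_mul_expMeasure {v : ℝ} (hv : v < 1) :
    ∫⁻ a, ENNReal.ofReal (Real.exp (v * a)) ∂expMeasure 1 = ENNReal.ofReal (1 / (1 - v)) := by
  have hv' : 0 < 1 - v := sub_pos.mpr hv
  have h1 := lintegral_exponentialPDF_eq_one hv'
  have h2 : ∀ a, exponentialPDF 1 a * ENNReal.ofReal (Real.exp (v * a)) =
      ENNReal.ofReal (1 / (1 - v)) * exponentialPDF (1 - v) a := by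
    intro a
    rw [exponentialPDF_eq, exponentialPDF_eq]
    split_ifs with ha
    · rw [← ENNReal.ofReal_mul (by positivity), ← ENNReal.ofReal_mul (by positivity)]
      congr 1
      rw [one_mul, one_mul, ← Real.exp_add, one_div, inv_mul_cancel_left₀ hv'.ne']
      ring_nf
    · simp
  have h3 : Measurable (exponentialPDF 1) := (measurable_exponentialPDFReal 1).ennreal_ofReal
  have h4 : Measurable (exponentialPDF (1 - v)) :=
    (measurable_exponentialPDFReal _).ennreal_ofReal
  rw [expMeasure, gammaMeasure]
  change ∫⁻ a, _ ∂volume.withDensity (exponentialPDF 1) = _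
  rw [lintegral_withDensity_eq_lintegral_mul _ h3 (by fun_prop)]
  simp only [Pi.mul_apply, h2]
  rw [lintegral_const_mul _ h4, h1, mul_one]

/-- A displacement by the `j`-th row of the exponential diagonal matrix multiplies
`exp (∑ i, y i * a i)` by `1 / (1 - a j)` on average. -/
theorem lintegral_exp_sum_add_row {c : ℕ} (a y : Fin c → ℝ) (j : Fin c) (ha : a j < 1) :
    ∫⁻ B, ENNReal.ofReal (Real.exp (∑ i, (y + B j) i * a i)) ∂expDiagonalLaw c =
      ENNReal.ofReal (Real.exp (∑ i, y i * a i) * (1 / (1 - a j))) := by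
  have hm : Measurable fun B : Matrix (Fin c) (Fin c) ℝ =>
      ENNReal.ofReal (Real.exp (∑ i, (y + B j) i * a i)) := by
    refine ENNReal.measurable_ofReal.comp (Real.measurable_exp.comp ?_)
    refine Finset.measurable_fun_sum _ fun i _ => Measurable.mul_const ?_ _
    exact measurable_const.add (measurable_matrix_entry j i)
  rw [expDiagonalLaw, lintegral_map hm (measurable_diagonal c)]
  have h1 : ∀ b : Fin c → ℝ, ENNReal.ofReal (Real.exp (∑ i, (y + Matrix.diagonal b j) i * a i)) =
      ENNReal.ofReal (Real.exp (∑ i, y i * a i)) * ENNReal.ofReal (Real.exp (a j * b j)) := by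
    intro b
    rw [← ENNReal.ofReal_mul (Real.exp_pos _).le, ← Real.exp_add]
    congr 2
    simp only [Pi.add_apply, add_mul, Finset.sum_add_distrib]
    congr 1
    rw [Finset.sum_eq_single j]
    · rw [Matrix.diagonal_apply_eq, mul_comm]
    · intro i _ hij
      rw [Matrix.diagonal_apply_ne _ hij.symm, zero_mul]
    · simp
  simp only [h1]
  rw [lintegral_const_mul _ (by fun_prop)]
  have h2 : ∫⁻ b : Fin c → ℝ, ENNReal.ofReal (Real.exp (a j * b j))
      ∂(Measure.pi fun _ : Fin c => expMeasure 1) =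
      ∫⁻ s, ENNReal.ofReal (Real.exp (a j * s)) ∂expMeasure 1 :=
    (measurePreserving_eval (fun _ : Fin c => expMeasure 1) j).lintegral_comp
      (f := fun s => ENNReal.ofReal (Real.exp (a j * s))) (by fun_prop)
  rw [h2, lintegral_exp_mul_expMeasure ha, ENNReal.ofReal_mul (Real.exp_pos _).le]

/-- `v` solves `v' = v / (1 - v)` on `[0, t]` and stays below `1`. -/
structure IsExpFlow (t : ℝ) (v : ℝ → ℝ) : Prop where
  continuous : Continuous v
  lt_one : ∀ s, v s < 1
  hasDerivAt : ∀ s ∈ Set.Ioo 0 t, HasDerivAt v (v s / (1 - v s)) s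

/-- With `τ` the time left, the contribution of a renewal at time `s ≤ τ` is `-d/ds` of `exp (-s S)
* φ (τ - s)`. Its integral is `φ τ - exp (-τ S) * φ 0`, and the subtracted term is exactly the
contribution of no renewal before `τ`. -/
theorem lintegral_flow_step {c : ℕ} {t : ℝ} {v : Fin c → ℝ → ℝ} (hv : ∀ i, IsExpFlow t (v i))
    {y : Fin c → ℝ} (hy : ∀ i, 0 ≤ y i) (hS : 0 < ∑ i, y i) {τ : ℝ} (hτ : 0 ≤ τ) (hτt : τ ≤ t) :
    ∑ j, ∫⁻ s in Set.Ioi 0, ENNReal.ofReal (y j * Real.exp (-(s * ∑ k, y k))) *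
      ∫⁻ B, (if τ < s then ENNReal.ofReal (Real.exp (∑ i, y i * v i 0))
        else ENNReal.ofReal (Real.exp (∑ i, (y + B j) i * v i (τ - s)))) ∂expDiagonalLaw c =
      ENNReal.ofReal (Real.exp (∑ i, y i * v i τ)) := by
  set S := ∑ k, y k with hSdef
  set φ : ℝ → ℝ := fun s => Real.exp (∑ i, y i * v i s) with hφ
  have hvc : ∀ i, Continuous (v i) := fun i => (hv i).continuous
  have hne : ∀ i s, 1 - v i s ≠ 0 := fun i s => (sub_pos.mpr ((hv i).lt_one s)).ne'
  have hpos : ∀ i s, 0 < 1 - v i s := fun i s => sub_pos.mpr ((hv i).lt_one s)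
  have hφc : Continuous φ := by fun_prop
  have hsplit : ∀ j, ∫⁻ s in Set.Ioi 0, ENNReal.ofReal (y j * Real.exp (-(s * S))) *
      ∫⁻ B, (if τ < s then ENNReal.ofReal (Real.exp (∑ i, y i * v i 0))
        else ENNReal.ofReal (Real.exp (∑ i, (y + B j) i * v i (τ - s)))) ∂expDiagonalLaw c =
      (∫⁻ s in Set.Ioc 0 τ, ENNReal.ofReal
        (Real.exp (-(s * S)) * φ (τ - s) * (y j * (1 / (1 - v j (τ - s)))))) +
      ENNReal.ofReal (Real.exp (-(τ * S)) * (y j / S) * φ 0) := by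
    intro j
    rw [← Set.Ioc_union_Ioi_eq_Ioi hτ,
      lintegral_union measurableSet_Ioi (Set.Ioc_disjoint_Ioi le_rfl)]
    congr 1
    · refine setLIntegral_congr_fun measurableSet_Ioc fun s hs => ?_
      simp only [if_neg (not_lt.mpr hs.2)]
      rw [lintegral_exp_sum_add_row (fun i => v i (τ - s)) y j ((hv j).lt_one _),
        ← ENNReal.ofReal_mul (mul_nonneg (hy j) (Real.exp_pos _).le)]
      congr 1
      ring
    · rw [setLIntegral_congr_fun (g := fun s => ENNReal.ofReal (y j * Real.exp (-(s * S))) *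
        ENNReal.ofReal (φ 0)) measurableSet_Ioi fun s hs => by
          simp only [if_pos (Set.mem_Ioi.mp hs), lintegral_const, measure_univ, mul_one, hφ]]
      rw [lintegral_mul_const _ (by fun_prop), lintegral_Ioi_rate (hy j) hS,
        ← ENNReal.ofReal_mul (mul_nonneg (Real.exp_pos _).le (div_nonneg (hy j) hS.le))]
  set g : ℝ → ℝ := fun s => Real.exp (-(s * S)) * φ (τ - s) *
    ∑ j, y j * (1 / (1 - v j (τ - s))) with hg
  have hgc : Continuous g := by
    refine Continuous.mul (by fun_prop) (continuous_finsetSum _ fun j _ => ?_)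
    exact continuous_const.mul (continuous_const.div (by fun_prop) fun s => hne j _)
  have hg0 : ∀ s, 0 ≤ g s := fun s => mul_nonneg (by positivity)
    (Finset.sum_nonneg fun j _ => mul_nonneg (hy j) (one_div_nonneg.mpr (hpos j _).le))
  rw [Finset.sum_congr rfl fun j _ => hsplit j, Finset.sum_add_distrib]
  have h1 : ∑ j, ∫⁻ s in Set.Ioc 0 τ, ENNReal.ofReal
        (Real.exp (-(s * S)) * φ (τ - s) * (y j * (1 / (1 - v j (τ - s))))) =
      ENNReal.ofReal (∫ s in (0 : ℝ)..τ, g s) := by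
    have hm : ∀ j, Measurable fun s => ENNReal.ofReal
        (Real.exp (-(s * S)) * φ (τ - s) * (y j * (1 / (1 - v j (τ - s))))) := by
      intro j
      have := (hvc j).measurable
      have := hφc.measurable
      fun_prop
    rw [← lintegral_finsetSum _ fun j _ => hm j, intervalIntegral.integral_of_le hτ,
      ofReal_integral_eq_lintegral_ofReal
        ((hgc.integrableOn_Icc (a := 0) (b := τ)).mono_set Set.Ioc_subset_Icc_self)
        (ae_of_all _ hg0)]
    refine lintegral_congr fun s => ?_
    rw [← ENNReal.ofReal_sum_of_nonneg, ← Finset.mul_sum]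
    intro j _
    exact mul_nonneg (by positivity) (mul_nonneg (hy j) (one_div_nonneg.mpr (hpos j _).le))
  have h2 : ∑ j, ENNReal.ofReal (Real.exp (-(τ * S)) * (y j / S) * φ 0) =
      ENNReal.ofReal (Real.exp (-(τ * S)) * φ 0) := by
    rw [← ENNReal.ofReal_sum_of_nonneg fun j _ =>
      mul_nonneg (mul_nonneg (Real.exp_pos _).le (div_nonneg (hy j) hS.le)) (Real.exp_pos _).le]
    rw [← Finset.sum_mul, ← Finset.mul_sum, ← Finset.sum_div, div_self hS.ne', mul_one]
  have h3 : ∫ s in (0 : ℝ)..τ, g s = φ τ - Real.exp (-(τ * S)) * φ 0 := by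
    have hd : ∀ s ∈ Set.Ioo 0 τ,
        HasDerivAt (fun s => -(Real.exp (-(s * S)) * φ (τ - s))) (g s) s := by
      intro s hs
      have hmem : τ - s ∈ Set.Ioo 0 t := ⟨by linarith [hs.2], by linarith [hs.1]⟩
      have hφd : HasDerivAt φ (φ (τ - s) * ∑ i, y i * (v i (τ - s) / (1 - v i (τ - s)))) (τ - s) :=
        (HasDerivAt.fun_sum fun i _ => ((hv i).hasDerivAt _ hmem).const_mul (y i)).exp
      have hφd' := hφd.comp_const_sub τ s
      have hed : HasDerivAt (fun s : ℝ => Real.exp (-(s * S)))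
          (Real.exp (-(s * S)) * (-(1 * S))) s :=
        (((hasDerivAt_id s).mul_const S).neg).exp
      refine ((hed.mul hφd').neg).congr_deriv ?_
      -- The differential equation enters here, through `1 / (1 - v) = 1 + v / (1 - v)`.
      have hsum : ∑ j, y j * (1 / (1 - v j (τ - s))) =
          S + ∑ i, y i * (v i (τ - s) / (1 - v i (τ - s))) := by
        rw [hSdef, ← Finset.sum_add_distrib]
        refine Finset.sum_congr rfl fun j _ => ?_
        field_simp [hne j (τ - s)]
        ring
      rw [hg]
      simp only
      rw [hsum]
      ring
    rw [intervalIntegral.integral_eq_sub_of_hasDerivAt_of_le hτ (by fun_prop) hd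
      (hgc.intervalIntegrable _ _)]
    simp only [sub_self, sub_zero, zero_mul, neg_zero, Real.exp_zero, one_mul]
    ring
  have h4 : 0 ≤ ∫ s in (0 : ℝ)..τ, g s :=
    intervalIntegral.integral_nonneg hτ fun s _ => hg0 s
  rw [h1, h2, ← ENNReal.ofReal_add h4 (by positivity), h3, sub_add_cancel]

/-! ### Decomposition by the number of renewals, and vanishing of the remainder. -/

namespace ContinuumPolyaWalk

variable {Ω : Type*} [MeasurableSpace Ω] {P : Measure Ω} {c : ℕ} {x : Fin c → ℝ}

/-- The expectation of `exp (∑ i, Y i * v i (t - T))` over the event `T ≤ t`, where `T` and `Y` are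
the time of the `n`-th renewal and the position after it. -/
noncomputable def beforeTerm (w : ContinuumPolyaWalk P (expDiagonalLaw c) x) (v : Fin c → ℝ → ℝ)
    (t : ℝ) (n : ℕ) : ENNReal :=
  ∫⁻ ω in {ω | w.renewalTime n ω ≤ t},
    ENNReal.ofReal (Real.exp (∑ i, w.pos n ω i * v i (t - w.renewalTime n ω))) ∂P

/-- The expectation of `exp (∑ i, X i t * a i)` over the event that there are exactly `n` renewals
up to time `t`. -/
noncomputable def exactTerm (w : ContinuumPolyaWalk P (expDiagonalLaw c) x) (a : Fin c → ℝ)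
    (t : ℝ) (n : ℕ) : ENNReal :=
  ∫⁻ ω in {ω | w.renewalTime n ω ≤ t ∧ t < w.renewalTime (n + 1) ω},
    ENNReal.ofReal (Real.exp (∑ i, w.pos n ω i * a i)) ∂P

theorem measurableSet_renewalTime_le (w : ContinuumPolyaWalk P (expDiagonalLaw c) x) (t : ℝ)
    (n : ℕ) :
    MeasurableSet {ω | w.renewalTime n ω ≤ t} :=
  measurableSet_le (w.measurable_renewalTime n) measurable_const

theorem measurableSet_exact (w : ContinuumPolyaWalk P (expDiagonalLaw c) x) (t : ℝ) (n : ℕ) :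
    MeasurableSet {ω | w.renewalTime n ω ≤ t ∧ t < w.renewalTime (n + 1) ω} :=
  (w.measurableSet_renewalTime_le t n).inter
    (measurableSet_lt measurable_const (w.measurable_renewalTime (n + 1)))

theorem renewalTime_zero (w : ContinuumPolyaWalk P (expDiagonalLaw c) x) (ω : Ω) :
    w.renewalTime 0 ω = 0 := Finset.sum_range_zero _

/-- `Set.ncard` is `0` on infinite sets, so `X` has its intended value only without explosion. Here
the counted indices form `Set.Iio n`; the index `k` stands for renewal `k + 1`. -/
theorem X_eq_of_exact (w : ContinuumPolyaWalk P (expDiagonalLaw c) x) {ω : Ω}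
    (hω : StrictMono fun n => w.renewalTime n ω) {t : ℝ} {n : ℕ}
    (h : w.renewalTime n ω ≤ t ∧ t < w.renewalTime (n + 1) ω) : w.X t ω = w.pos n ω := by
  have : {k : ℕ | w.renewalTime (k + 1) ω ≤ t} = Set.Iio n := by
    ext k
    simp only [Set.mem_ofPred_eq, Set.mem_Iio]
    constructor
    · intro hk
      by_contra hkn
      have := hω.monotone (Nat.succ_le_succ (not_lt.mp hkn))
      exact absurd (h.2.trans_le this) (not_lt.mpr hk)
    · intro hk
      exact (hω.monotone (Nat.succ_le_of_lt hk)).trans h.1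
  rw [X, renewalCount, this]
  simp [pos, Set.ncard_eq_toFinset_card']

variable [IsProbabilityMeasure P]

theorem ae_strictMono_renewalTime (w : ContinuumPolyaWalk P (expDiagonalLaw c) x)
    (hx : ∀ i, 0 ≤ x i) (hx0 : x ≠ 0) : ∀ᵐ ω ∂P, StrictMono fun n => w.renewalTime n ω := by
  filter_upwards [ae_all_iff.mpr fun n => w.ae_wait_pos hx hx0 n] with ω h
  refine strictMono_nat_of_lt_succ fun n => ?_
  rw [renewalTime_succ]
  exact lt_add_of_pos_right _ (h n)

/-- Given `T n ≤ t`, either the next renewal falls after `t` or it does not; `lintegral_flow_step`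
with `τ = t - T n` adds up the two cases. -/
theorem exactTerm_add_beforeTerm_succ (w : ContinuumPolyaWalk P (expDiagonalLaw c) x)
    (hx : ∀ i, 0 ≤ x i) (hx0 : x ≠ 0) {t : ℝ} {v : Fin c → ℝ → ℝ} (hv : ∀ i, IsExpFlow t (v i))
    (n : ℕ) :
    w.exactTerm (fun i => v i 0) t n + w.beforeTerm v t (n + 1) = w.beforeTerm v t n := by
  have hvm : ∀ i, Measurable (v i) := fun i => (hv i).continuous.measurable
  -- Both integrands on the left as one function of the past, the waiting time and the matrix, set
  -- to zero when `T n > t`.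
  let F : Fin c → ℝ × (Fin c → ℝ) → ℝ → Matrix (Fin c) (Fin c) ℝ → ENNReal := fun j h s B =>
    if h.1 ≤ t then
      (if t - h.1 < s then ENNReal.ofReal (Real.exp (∑ i, h.2 i * v i 0))
        else ENNReal.ofReal (Real.exp (∑ i, (h.2 + B j) i * v i (t - h.1 - s))))
    else 0
  have hF : ∀ j, Measurable fun p : (ℝ × (Fin c → ℝ)) × ℝ × Matrix (Fin c) (Fin c) ℝ =>
      F j p.1 p.2.1 p.2.2 := by
    intro j
    refine Measurable.ite (measurableSet_le (by fun_prop) measurable_const) ?_ measurable_const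
    refine Measurable.ite (measurableSet_lt (by fun_prop) (by fun_prop)) (by fun_prop) ?_
    refine ENNReal.measurable_ofReal.comp (Real.measurable_exp.comp ?_)
    refine Finset.measurable_fun_sum _ fun i _ => Measurable.mul ?_ (by fun_prop)
    exact Measurable.add (f := fun p : (ℝ × (Fin c → ℝ)) × ℝ × Matrix (Fin c) (Fin c) ℝ => p.1.2 i)
      (by fun_prop) ((measurable_matrix_entry j i).comp (by fun_prop))
  have h := w.lintegral_step hx hx0 n hF
  have hpm := w.measurable_pos n
  have hpm' := w.measurable_pos (n + 1)
  have hTm := w.measurable_renewalTime n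
  have hTm' := w.measurable_renewalTime (n + 1)
  have hmono := w.ae_strictMono_renewalTime hx hx0
  have hL : ∫⁻ ω, F (w.colour n ω) (w.renewalTime n ω, w.pos n ω) (w.wait n ω) (w.nav n ω) ∂P =
      w.exactTerm (fun i => v i 0) t n + w.beforeTerm v t (n + 1) := by
    rw [exactTerm, beforeTerm, ← lintegral_indicator (w.measurableSet_exact t n),
      ← lintegral_indicator (w.measurableSet_renewalTime_le t (n + 1)), ← lintegral_add_left]
    · refine lintegral_congr_ae ?_
      filter_upwards [hmono] with ω hω
      have hlt : w.renewalTime n ω < w.renewalTime (n + 1) ω := hω n.lt_succ_self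
      have hs := w.renewalTime_succ n ω
      simp only [F, Set.indicator, Set.mem_ofPred_eq]
      by_cases h1 : w.renewalTime n ω ≤ t
      · by_cases h2 : t < w.renewalTime (n + 1) ω
        · rw [if_pos h1, if_pos (by linarith), if_pos ⟨h1, h2⟩, if_neg (not_le.mpr h2), add_zero]
        · rw [if_pos h1, if_neg (by linarith), if_neg (fun h => h2 h.2), if_pos (not_lt.mp h2),
            zero_add, pos_succ, hs, sub_sub]
      · rw [if_neg h1, if_neg (fun h => h1 h.1), if_neg (by linarith), add_zero]
    · exact Measurable.indicator (by fun_prop) (w.measurableSet_exact t n)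
  rw [← hL, h, beforeTerm, ← lintegral_indicator (w.measurableSet_renewalTime_le t n)]
  refine lintegral_congr_ae ?_
  filter_upwards [hmono, w.ae_pos_nonneg hx hx0 n] with ω hω hpos
  have h0 : 0 ≤ w.renewalTime n ω := by
    have := hω.monotone (Nat.zero_le n)
    simpa only [renewalTime_zero] using this
  simp only [F, Set.indicator, Set.mem_ofPred_eq]
  split_ifs with h1
  · exact lintegral_flow_step hv hpos.1 hpos.2 (by linarith) (by linarith)
  · simp

theorem sum_exactTerm_add_beforeTerm (w : ContinuumPolyaWalk P (expDiagonalLaw c) x)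
    (hx : ∀ i, 0 ≤ x i) (hx0 : x ≠ 0) {t : ℝ} (ht : 0 ≤ t) {v : Fin c → ℝ → ℝ}
    (hv : ∀ i, IsExpFlow t (v i)) (n : ℕ) :
    ∑ k ∈ Finset.range n, w.exactTerm (fun i => v i 0) t k + w.beforeTerm v t n =
      ENNReal.ofReal (Real.exp (∑ i, x i * v i t)) := by
  induction n with
  | zero =>
    have : {ω : Ω | w.renewalTime 0 ω ≤ t} = Set.univ := by
      ext ω; simpa [renewalTime_zero] using ht
    rw [Finset.sum_range_zero, zero_add, beforeTerm, this]
    simp [renewalTime_zero, positionAfter]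
  | succ n ih =>
    rw [Finset.sum_range_succ, add_assoc, w.exactTerm_add_beforeTerm_succ hx hx0 hv, ih]

/-- Whatever the type, a renewal adds an independent `Exp(1)` variable to the coordinate sum, and `E
exp (-A) = 1/2`. The geometric decay makes small positions after many renewals unlikely. -/
theorem lintegral_exp_neg_sum_pos (w : ContinuumPolyaWalk P (expDiagonalLaw c) x)
    (hx : ∀ i, 0 ≤ x i) (hx0 : x ≠ 0) (n : ℕ) :
    ∫⁻ ω, ENNReal.ofReal (Real.exp (∑ i, w.pos n ω i * (-1))) ∂P =
      ENNReal.ofReal (1 / 2) ^ n * ENNReal.ofReal (Real.exp (∑ i, x i * (-1))) := by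
  induction n with
  | zero => simp [positionAfter]
  | succ n ih =>
    let F : Fin c → ℝ × (Fin c → ℝ) → ℝ → Matrix (Fin c) (Fin c) ℝ → ENNReal := fun j h _ B =>
      ENNReal.ofReal (Real.exp (∑ i, (h.2 + B j) i * (-1)))
    have hF : ∀ j, Measurable fun p : (ℝ × (Fin c → ℝ)) × ℝ × Matrix (Fin c) (Fin c) ℝ =>
        F j p.1 p.2.1 p.2.2 := by
      intro j
      refine ENNReal.measurable_ofReal.comp (Real.measurable_exp.comp ?_)
      refine Finset.measurable_fun_sum _ fun i _ => Measurable.mul_const ?_ _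
      exact Measurable.add
        (f := fun p : (ℝ × (Fin c → ℝ)) × ℝ × Matrix (Fin c) (Fin c) ℝ => p.1.2 i)
        (by fun_prop) ((measurable_matrix_entry j i).comp (by fun_prop))
    have h := w.lintegral_step hx hx0 n hF
    have hpm := w.measurable_pos n
    rw [pow_succ', mul_assoc, ← ih, ← lintegral_const_mul _ (by fun_prop)]
    refine h.trans (lintegral_congr_ae ?_)
    filter_upwards [w.ae_pos_nonneg hx hx0 n] with ω hpos
    simp only [F]
    have hj : ∀ j, ∫⁻ s in Set.Ioi 0,
        ENNReal.ofReal (w.pos n ω j * Real.exp (-(s * ∑ k, w.pos n ω k))) *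
          ∫⁻ B, ENNReal.ofReal (Real.exp (∑ i, (w.pos n ω + B j) i * (-1))) ∂expDiagonalLaw c =
        ENNReal.ofReal (w.pos n ω j / ∑ k, w.pos n ω k) *
          (ENNReal.ofReal (1 / 2) * ENNReal.ofReal (Real.exp (∑ i, w.pos n ω i * (-1)))) := by
      intro j
      rw [lintegral_mul_const _ (by fun_prop), lintegral_Ioi_rate (hpos.1 j) hpos.2,
        lintegral_exp_sum_add_row (fun _ => -1) _ j (by norm_num), zero_mul, neg_zero,
        Real.exp_zero, one_mul, mul_comm (Real.exp _), ENNReal.ofReal_mul (by norm_num)]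
      norm_num
    rw [Finset.sum_congr rfl fun j _ => hj j, ← Finset.sum_mul,
      ← ENNReal.ofReal_sum_of_nonneg fun j _ => div_nonneg (hpos.1 j) hpos.2.le,
      ← Finset.sum_div, div_self hpos.2.ne', ENNReal.ofReal_one, one_mul]

theorem tendsto_lintegral_exp_neg_sum_pos (w : ContinuumPolyaWalk P (expDiagonalLaw c) x)
    (hx : ∀ i, 0 ≤ x i) (hx0 : x ≠ 0) :
    Tendsto (fun n => ∫⁻ ω, ENNReal.ofReal (Real.exp (∑ i, w.pos n ω i * (-1))) ∂P) atTop
      (𝓝 0) := by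
  simp only [w.lintegral_exp_neg_sum_pos hx hx0]
  have h : Tendsto (fun n : ℕ => ENNReal.ofReal (1 / 2) ^ n) atTop (𝓝 0) :=
    ENNReal.tendsto_pow_atTop_nhds_zero_of_lt_one (by
      rw [ENNReal.ofReal_lt_one]; norm_num)
  simpa using ENNReal.Tendsto.mul_const h (Or.inr ENNReal.ofReal_ne_top)

/-- If `v` is dominated by a flow with a uniform gap, then `exp (y · v)` is at most a small multiple
of the exponential of the dominating flow, up to a multiple of `exp (-|y|)`. -/
theorem exists_exp_sum_le {c : ℕ} {M δ η : ℝ} (hM : 0 ≤ M) (hδ : 0 < δ) (hη : 0 < η) :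
    ∃ C : ℝ, 0 ≤ C ∧ ∀ (y a b : Fin c → ℝ), (∀ i, 0 ≤ y i) → (∀ i, a i ≤ M) →
      (∀ i, a i + δ ≤ b i) → Real.exp (∑ i, y i * a i) ≤
        η * Real.exp (∑ i, y i * b i) + C * Real.exp (∑ i, y i * (-1)) := by
  -- The threshold for `|y| = ∑ i, y i`: above `K` the gap yields the factor `exp (-δ K) ≤ η`; below
  -- it, `M |y| ≤ (M + 1) K - |y|`, whence the constant `C`.
  obtain ⟨K, hK⟩ : ∃ K : ℝ, Real.exp (-(δ * K)) ≤ η := by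
    refine ⟨-Real.log η / δ, ?_⟩
    rw [mul_div_cancel₀ _ hδ.ne', neg_neg, Real.exp_log hη]
  refine ⟨Real.exp ((M + 1) * K), (Real.exp_pos _).le, fun y a b hy ha hab => ?_⟩
  have hsum : ∑ i, y i * a i + δ * ∑ i, y i ≤ ∑ i, y i * b i := by
    rw [Finset.mul_sum, ← Finset.sum_add_distrib]
    refine Finset.sum_le_sum fun i _ => ?_
    nlinarith [mul_le_mul_of_nonneg_left (hab i) (hy i)]
  have hsum' : ∑ i, y i * a i ≤ M * ∑ i, y i := by
    rw [Finset.mul_sum]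
    refine Finset.sum_le_sum fun i _ => ?_
    nlinarith [mul_le_mul_of_nonneg_left (ha i) (hy i)]
  rcases le_total K (∑ i, y i) with h | h
  · refine le_add_of_le_of_nonneg ?_ (by positivity)
    refine le_trans ?_ (mul_le_mul_of_nonneg_right hK (Real.exp_pos _).le)
    rw [← Real.exp_add, Real.exp_le_exp]
    nlinarith
  · refine le_add_of_nonneg_of_le (by positivity) ?_
    rw [← Real.exp_add, Real.exp_le_exp, ← Finset.sum_mul]
    nlinarith

/-- The remainder for the larger flow `v'` is bounded in `n` by its own conserved total. The
remainder for `v` is at most `η` times that bound plus a multiple of `E exp (-|Y n|)`, which tends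
to `0`; then `η` is arbitrary. -/
theorem tendsto_beforeTerm (w : ContinuumPolyaWalk P (expDiagonalLaw c) x)
    (hx : ∀ i, 0 ≤ x i) (hx0 : x ≠ 0) {t : ℝ} (ht : 0 ≤ t) {v v' : Fin c → ℝ → ℝ}
    (hv : ∀ i, IsExpFlow t (v i)) (hv' : ∀ i, IsExpFlow t (v' i)) {δ : ℝ} (hδ : 0 < δ)
    (hvv' : ∀ i s, v i s + δ ≤ v' i s) :
    Tendsto (w.beforeTerm v t) atTop (𝓝 0) := by
  set L := Real.exp (∑ i, x i * v' i t) with hL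
  have hLpos : 0 < L := Real.exp_pos _
  have hpm := w.measurable_pos
  have hTm := w.measurable_renewalTime
  have hvm : ∀ i, Measurable (v i) := fun i => (hv i).continuous.measurable
  have hvm' : ∀ i, Measurable (v' i) := fun i => (hv' i).continuous.measurable
  have hbound : ∀ η : ℝ, 0 < η → ∃ C : ENNReal, C ≠ ⊤ ∧ ∀ n, w.beforeTerm v t n ≤
      ENNReal.ofReal (η * L) +
        C * ∫⁻ ω, ENNReal.ofReal (Real.exp (∑ i, w.pos n ω i * (-1))) ∂P := by
    intro η hη
    obtain ⟨C, hC, hle⟩ := exists_exp_sum_le (c := c) zero_le_one hδ hη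
    refine ⟨ENNReal.ofReal C, ENNReal.ofReal_ne_top, fun n => ?_⟩
    have h1 : w.beforeTerm v t n ≤ ENNReal.ofReal η * w.beforeTerm v' t n + ENNReal.ofReal C *
        ∫⁻ ω in {ω | w.renewalTime n ω ≤ t},
          ENNReal.ofReal (Real.exp (∑ i, w.pos n ω i * (-1))) ∂P := by
      rw [beforeTerm, beforeTerm, ← lintegral_const_mul _ (by fun_prop),
        ← lintegral_const_mul _ (by fun_prop), ← lintegral_add_left (by fun_prop)]
      refine lintegral_mono_ae (ae_restrict_of_ae ?_)
      filter_upwards [w.ae_pos_nonneg hx hx0 n] with ω hpos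
      rw [← ENNReal.ofReal_mul hη.le, ← ENNReal.ofReal_mul hC,
        ← ENNReal.ofReal_add (by positivity) (by positivity)]
      exact ENNReal.ofReal_le_ofReal (hle _ _ _ hpos.1 (fun i => ((hv i).lt_one _).le)
        fun i => hvv' i _)
    refine h1.trans (add_le_add ?_ ?_)
    · rw [ENNReal.ofReal_mul hη.le]
      refine mul_le_mul_right ?_ _
      rw [hL, ← w.sum_exactTerm_add_beforeTerm hx hx0 ht hv' n]
      exact le_add_self
    · exact mul_le_mul_right (setLIntegral_le_lintegral _ _) _
  rw [ENNReal.tendsto_nhds_zero]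
  intro ε hε
  obtain ⟨r, hr0, hrε⟩ : ∃ r : ℝ, 0 < r ∧ ENNReal.ofReal r < ε := by
    obtain ⟨q, hq0, hq⟩ := ENNReal.lt_iff_exists_nnreal_btwn.mp hε
    exact ⟨q, by exact_mod_cast hq0, by simpa using hq⟩
  obtain ⟨C, hC, hle⟩ := hbound (r / 2 / L) (by positivity)
  have hlim : Tendsto (fun n => C * ∫⁻ ω, ENNReal.ofReal
      (Real.exp (∑ i, w.pos n ω i * (-1))) ∂P) atTop (𝓝 0) := by
    simpa using ENNReal.Tendsto.const_mul (w.tendsto_lintegral_exp_neg_sum_pos hx hx0) (Or.inr hC)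
  filter_upwards [(ENNReal.tendsto_nhds_zero.mp hlim) (ENNReal.ofReal (r / 2))
    (by simpa using hr0)] with n hn
  refine (hle n).trans ?_
  rw [div_mul_cancel₀ _ hLpos.ne']
  refine (add_le_add le_rfl hn).trans ?_
  rw [← ENNReal.ofReal_add (by positivity) (by positivity), add_halves]
  exact hrε.le

theorem tsum_exactTerm (w : ContinuumPolyaWalk P (expDiagonalLaw c) x)
    (hx : ∀ i, 0 ≤ x i) (hx0 : x ≠ 0) {t : ℝ} (ht : 0 ≤ t) {v v' : Fin c → ℝ → ℝ}
    (hv : ∀ i, IsExpFlow t (v i)) (hv' : ∀ i, IsExpFlow t (v' i)) {δ : ℝ} (hδ : 0 < δ)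
    (hvv' : ∀ i s, v i s + δ ≤ v' i s) :
    ∑' n, w.exactTerm (fun i => v i 0) t n = ENNReal.ofReal (Real.exp (∑ i, x i * v i t)) := by
  have h1 := (ENNReal.summable (f := w.exactTerm (fun i => v i 0) t)).hasSum.tendsto_sum_nat
  have h2 := h1.add (w.tendsto_beforeTerm hx hx0 ht hv hv' hδ hvv')
  simp only [w.sum_exactTerm_add_beforeTerm hx hx0 ht hv, add_zero] at h2
  exact (tendsto_nhds_unique h2 tendsto_const_nhds)

end ContinuumPolyaWalk

/-! ### The principal branch of Lambert's function. -/

theorem hasDerivAt_mul_exp (w : ℝ) :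
    HasDerivAt (fun w : ℝ => w * Real.exp w) ((1 + w) * Real.exp w) w :=
  ((hasDerivAt_id w).mul (Real.hasDerivAt_exp w)).congr_deriv (by simp only [id]; ring)

theorem strictMonoOn_mul_exp : StrictMonoOn (fun w : ℝ => w * Real.exp w) (Set.Ici (-1)) := by
  refine strictMonoOn_of_deriv_pos (convex_Ici _) (by fun_prop) fun w hw => ?_
  rw [interior_Ici, Set.mem_Ioi] at hw
  rw [(hasDerivAt_mul_exp w).deriv]
  exact mul_pos (by linarith) (Real.exp_pos _)

theorem exists_mul_exp_eq {z : ℝ} (hz : -Real.exp (-1) ≤ z) :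
    ∃ w ∈ Set.Ici (-1 : ℝ), w * Real.exp w = z := by
  -- Upper end for the intermediate value theorem: `w * exp w ≥ w` when `w ≥ 0`.
  have hb : (-1 : ℝ) ≤ max z 0 := le_max_of_le_right (by norm_num)
  have hz' : z ≤ max z 0 * Real.exp (max z 0) := by
    have h1 : 1 ≤ Real.exp (max z 0) := Real.one_le_exp (le_max_right _ _)
    nlinarith [le_max_left z 0, le_max_right z 0]
  obtain ⟨w, hw, h⟩ := intermediate_value_Icc hb
    (f := fun w : ℝ => w * Real.exp w) (by fun_prop) ⟨by simpa using hz, hz'⟩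
  exact ⟨w, hw.1, h⟩

theorem neg_one_le_lambertW {z : ℝ} (hz : -Real.exp (-1) ≤ z) : -1 ≤ lambertW z :=
  Function.invFunOn_mem (exists_mul_exp_eq hz)

theorem lambertW_mul_exp {z : ℝ} (hz : -Real.exp (-1) ≤ z) :
    lambertW z * Real.exp (lambertW z) = z :=
  Function.invFunOn_eq (f := fun w : ℝ => w * Real.exp w) (exists_mul_exp_eq hz)

theorem neg_exp_neg_one_le_mul_exp {w : ℝ} (hw : -1 ≤ w) : -Real.exp (-1) ≤ w * Real.exp w := by
  simpa using strictMonoOn_mul_exp.monotoneOn (Set.self_mem_Ici) hw hw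

theorem lambertW_of_mul_exp {w : ℝ} (hw : -1 ≤ w) : lambertW (w * Real.exp w) = w := by
  have h := neg_exp_neg_one_le_mul_exp hw
  exact strictMonoOn_mul_exp.injOn (neg_one_le_lambertW h) hw (lambertW_mul_exp h)

theorem lambertW_zero : lambertW 0 = 0 := by
  simpa using lambertW_of_mul_exp (w := 0) (by norm_num)

theorem strictMonoOn_lambertW : StrictMonoOn lambertW (Set.Ici (-Real.exp (-1))) := by
  intro a ha b hb hab
  rw [← strictMonoOn_mul_exp.lt_iff_lt (neg_one_le_lambertW ha) (neg_one_le_lambertW hb)]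
  simpa only [lambertW_mul_exp ha, lambertW_mul_exp hb] using hab

theorem lambertW_image_Ici : lambertW '' Set.Ici (-Real.exp (-1)) = Set.Ici (-1) := by
  ext w
  constructor
  · rintro ⟨z, hz, rfl⟩
    exact neg_one_le_lambertW hz
  · exact fun hw => ⟨_, neg_exp_neg_one_le_mul_exp hw, lambertW_of_mul_exp hw⟩

theorem lambertW_neg_exp_neg_one : lambertW (-Real.exp (-1)) = -1 := by
  simpa using lambertW_of_mul_exp (w := -1) le_rfl

theorem neg_one_lt_lambertW {z : ℝ} (hz : -Real.exp (-1) < z) : -1 < lambertW z := by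
  simpa only [lambertW_neg_exp_neg_one] using
    strictMonoOn_lambertW Set.self_mem_Ici hz.le hz

/-- A monotone function whose image contains a neighbourhood of the value has no jump. -/
theorem continuousAt_lambertW {z : ℝ} (hz : -Real.exp (-1) < z) : ContinuousAt lambertW z := by
  refine strictMonoOn_lambertW.continuousAt_of_image_mem_nhds (Ici_mem_nhds hz) ?_
  rw [lambertW_image_Ici]
  exact Ici_mem_nhds (neg_one_lt_lambertW hz)

theorem continuousOn_lambertW : ContinuousOn lambertW (Set.Ici (-Real.exp (-1))) := by
  intro z hz
  rcases eq_or_lt_of_le (Set.mem_Ici.mp hz) with h | h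
  · subst h
    refine strictMonoOn_lambertW.continuousWithinAt_right_of_surjOn self_mem_nhdsWithin ?_
    intro w hw
    rw [lambertW_neg_exp_neg_one] at hw
    rw [lambertW_image_Ici]
    exact (Set.mem_Ioi.mp hw).le
  · exact (continuousAt_lambertW h).continuousWithinAt

theorem hasDerivAt_lambertW {z : ℝ} (hz : -Real.exp (-1) < z) :
    HasDerivAt lambertW ((1 + lambertW z) * Real.exp (lambertW z))⁻¹ z := by
  have h := neg_one_lt_lambertW hz
  refine (hasDerivAt_mul_exp (lambertW z)).of_local_left_inverse (continuousAt_lambertW hz)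
    (mul_pos (by linarith) (Real.exp_pos _)).ne' ?_
  filter_upwards [Ioi_mem_nhds hz] with y hy using lambertW_mul_exp (le_of_lt hy)

/-! ### The explicit flow and its comparison with a larger one. -/

/-- The solution of `v' = v / (1 - v)`, `v 0 = u` on `[0, t]`, extended by constants. -/
noncomputable def lambertFlow (t u s : ℝ) : ℝ :=
  -lambertW (-(u * Real.exp (max 0 (min t s) - u)))

/-- The clamped time is at most `t`. For `u ≥ 0` the expression increases with time, so the bound at
`t` suffices; for `u ≤ 0` it is nonpositive. -/
theorem lambertFlow_arg_lt {t u s : ℝ} (ht : 0 ≤ t) (h : u * Real.exp (t - u) < Real.exp (-1)) :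
    -Real.exp (-1) < -(u * Real.exp (max 0 (min t s) - u)) := by
  refine neg_lt_neg ?_
  rcases le_total u 0 with hu | hu
  · exact (mul_nonpos_of_nonpos_of_nonneg hu (Real.exp_pos _).le).trans_lt (Real.exp_pos _)
  · refine lt_of_le_of_lt (mul_le_mul_of_nonneg_left (Real.exp_le_exp.mpr ?_) hu) h
    linarith [max_le ht (min_le_left t s)]

theorem lambertFlow_zero {t u : ℝ} (ht : 0 ≤ t) (hu : u < 1) : lambertFlow t u 0 = u := by
  have : -(u * Real.exp (max 0 (min t 0) - u)) = -u * Real.exp (-u) := by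
    rw [min_eq_right ht, max_self, zero_sub, neg_mul]
  -- The hypothesis `u < 1` puts `-u` on the principal branch.
  rw [lambertFlow, this, lambertW_of_mul_exp (by linarith), neg_neg]

theorem lambertFlow_self {t u : ℝ} (ht : 0 ≤ t) :
    lambertFlow t u t = -lambertW (-(u * Real.exp (t - u))) := by
  rw [lambertFlow, min_self, max_eq_right ht]

theorem isExpFlow_lambertFlow {t u : ℝ} (ht : 0 ≤ t) (h : u * Real.exp (t - u) < Real.exp (-1)) :
    IsExpFlow t (lambertFlow t u) where
  continuous := by
    rw [continuous_iff_continuousAt]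
    intro s
    refine ContinuousAt.neg (ContinuousAt.comp (f := fun s => -(u * Real.exp (max 0 (min t s) - u)))
      (continuousAt_lambertW (lambertFlow_arg_lt ht h)) ?_)
    fun_prop
  lt_one s := by
    have := neg_one_lt_lambertW (lambertFlow_arg_lt (s := s) ht h)
    rw [lambertFlow]
    linarith
  hasDerivAt s hs := by
    have hz := lambertFlow_arg_lt (s := s) ht h
    have hclamp : ∀ r ∈ Set.Ioo 0 t, max 0 (min t r) = r := fun r hr => by
      rw [min_eq_right hr.2.le, max_eq_right hr.1.le]
    have heq : lambertFlow t u =ᶠ[𝓝 s] fun r => -lambertW (-(u * Real.exp (r - u))) := by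
      filter_upwards [isOpen_Ioo.mem_nhds hs] with r hr
      rw [lambertFlow, hclamp r hr]
    rw [heq.eq_of_nhds]
    rw [hclamp s hs] at hz
    have hin : HasDerivAt (fun r => -(u * Real.exp (r - u))) (-(u * Real.exp (s - u))) s := by
      have := ((((hasDerivAt_id s).sub_const u).exp).const_mul u).fun_neg
      simpa using this
    refine HasDerivAt.congr_of_eventuallyEq ?_ heq
    refine ((hasDerivAt_lambertW hz).comp s hin).neg.congr_deriv ?_
    have hW := neg_one_lt_lambertW hz
    have hWz := lambertW_mul_exp hz.le
    set z := -(u * Real.exp (s - u))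
    have h1 : 1 + lambertW z ≠ 0 := by linarith
    have h2 : 1 - -lambertW z ≠ 0 := by rwa [sub_neg_eq_add]
    -- The argument `z` satisfies `z' = -u * exp (s - u) = z`. Writing this factor as `W * exp W`
    -- turns the derivative of `-W` into `-W / (1 + W)`.
    nth_rewrite 3 [← hWz]
    field_simp [Real.exp_ne_zero]
    ring

theorem mul_exp_sub_lt {t u u' : ℝ} (huu' : u < u') (hu' : u' ≤ 1) :
    u * Real.exp (t - u) < u' * Real.exp (t - u') := by
  have h1 : -u' * Real.exp (-u') < -u * Real.exp (-u) :=
    strictMonoOn_mul_exp (Set.mem_Ici.mpr (by linarith)) (Set.mem_Ici.mpr (by linarith))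
      (neg_lt_neg huu')
  have h2 : u * Real.exp (-u) < u' * Real.exp (-u') := by linarith
  rw [sub_eq_neg_add, sub_eq_neg_add, Real.exp_add, Real.exp_add, ← mul_assoc, ← mul_assoc]
  exact mul_lt_mul_of_pos_right h2 (Real.exp_pos _)

theorem lambertFlow_lt {t u u' s : ℝ} (ht : 0 ≤ t) (huu' : u < u') (hu' : u' < 1)
    (h : u * Real.exp (t - u) < Real.exp (-1)) (h' : u' * Real.exp (t - u') < Real.exp (-1)) :
    lambertFlow t u s < lambertFlow t u' s :=
  neg_lt_neg (strictMonoOn_lambertW (lambertFlow_arg_lt ht h').le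
    (lambertFlow_arg_lt ht h).le (neg_lt_neg (mul_exp_sub_lt huu' hu'.le)))

/-- The strict inequality survives a small increase of `u`. The difference of the two flows is
positive and continuous, so it has a positive minimum on `[0, t]`; clamping extends the bound to all
times. -/
theorem exists_lambertFlow_gap {t u : ℝ} (ht : 0 ≤ t) (hu : u < 1)
    (h : u * Real.exp (t - u) < Real.exp (-1)) :
    ∃ u' δ : ℝ, 0 < δ ∧ u' * Real.exp (t - u') < Real.exp (-1) ∧
      ∀ s, lambertFlow t u s + δ ≤ lambertFlow t u' s := by
  have hcont : Continuous fun r : ℝ => r * Real.exp (t - r) := by fun_prop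
  have h1 : ∀ᶠ r in 𝓝[>] u, r * Real.exp (t - r) < Real.exp (-1) :=
    (hcont.tendsto u).mono_left nhdsWithin_le_nhds |>.eventually_lt_const h
  have h2 : ∀ᶠ r in 𝓝[>] u, r ∈ Set.Ioo u 1 := Ioo_mem_nhdsGT hu
  obtain ⟨u', hu'1, hu'2⟩ := (h1.and h2).exists
  have hc : Continuous fun s => lambertFlow t u' s - lambertFlow t u s :=
    (isExpFlow_lambertFlow ht hu'1).continuous.sub (isExpFlow_lambertFlow ht h).continuous
  obtain ⟨s₀, -, hs₀⟩ := isCompact_Icc.exists_isMinOn (Set.nonempty_Icc.mpr ht) hc.continuousOn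
  refine ⟨u', _, sub_pos.mpr (lambertFlow_lt (s := s₀) ht hu'2.1 hu'2.2 h hu'1), hu'1, fun s => ?_⟩
  have hs : max 0 (min t s) ∈ Set.Icc 0 t :=
    ⟨le_max_left _ _, max_le ht (min_le_left _ _)⟩
  have h3 := hs₀ hs
  have h4 : ∀ r, lambertFlow t r (max 0 (min t s)) = lambertFlow t r s := by
    intro r
    rw [lambertFlow, min_eq_right hs.2, max_eq_right hs.1, lambertFlow]
  simp only [Set.mem_ofPred_eq, h4] at h3
  linarith

/-! ### Joint moment generating function and absence of explosion. -/

namespace ContinuumPolyaWalk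

variable {Ω : Type*} [MeasurableSpace Ω] {P : Measure Ω} {c : ℕ} {x : Fin c → ℝ}
  [IsProbabilityMeasure P]

theorem tsum_exactTerm_lambert (w : ContinuumPolyaWalk P (expDiagonalLaw c) x)
    (hx : ∀ i, 0 ≤ x i) (hx0 : x ≠ 0) {t : ℝ} (ht : 0 ≤ t) {u : Fin c → ℝ} (hu : ∀ i, u i < 1)
    (h : ∀ i, u i * Real.exp (t - u i) < Real.exp (-1)) :
    ∑' n, w.exactTerm u t n =
      ENNReal.ofReal (Real.exp (-∑ i, x i * lambertW (-(u i * Real.exp (t - u i))))) := by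
  choose u' δ hδ hu' hgap using fun i => exists_lambertFlow_gap ht (hu i) (h i)
  -- A single gap for all coordinates: any small enough positive `d` lies below the finitely many `δ
  -- i`.
  have hev : ∀ᶠ d in 𝓝[>] (0 : ℝ), ∀ i, d ≤ δ i := by
    rw [eventually_all]
    exact fun i => nhdsWithin_le_nhds (Iic_mem_nhds (hδ i))
  obtain ⟨d, hd, hd0⟩ := (hev.and self_mem_nhdsWithin).exists
  have key := w.tsum_exactTerm hx hx0 ht (v := fun i => lambertFlow t (u i))
    (v' := fun i => lambertFlow t (u' i)) (fun i => isExpFlow_lambertFlow ht (h i))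
    (fun i => isExpFlow_lambertFlow ht (hu' i)) hd0
    fun i s => (add_le_add_right (hd i) _).trans (hgap i s)
  simp only [lambertFlow_zero ht (hu _), lambertFlow_self ht, mul_neg,
    Finset.sum_neg_distrib] at key
  exact key

theorem aedisjoint_exact (w : ContinuumPolyaWalk P (expDiagonalLaw c) x)
    (hx : ∀ i, 0 ≤ x i) (hx0 : x ≠ 0) (t : ℝ) :
    Pairwise (Function.onFun (AEDisjoint P)
      fun n => {ω | w.renewalTime n ω ≤ t ∧ t < w.renewalTime (n + 1) ω}) := by
  intro m n hmn
  refine measure_mono_null (t := {ω | ¬ StrictMono fun n => w.renewalTime n ω}) ?_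
    (w.ae_strictMono_renewalTime hx hx0)
  rintro ω ⟨⟨hm1, hm2⟩, hn1, hn2⟩ hω
  rcases lt_or_gt_of_ne hmn with h | h
  · exact absurd ((hω.monotone (Nat.succ_le_of_lt h)).trans hn1) (not_le.mpr hm2)
  · exact absurd ((hω.monotone (Nat.succ_le_of_lt h)).trans hm1) (not_le.mpr hn2)

/-- The walk does not explode: almost surely the number of renewals up to time `t` is finite. -/
theorem ae_exists_exact (w : ContinuumPolyaWalk P (expDiagonalLaw c) x)
    (hx : ∀ i, 0 ≤ x i) (hx0 : x ≠ 0) {t : ℝ} (ht : 0 ≤ t) :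
    ∀ᵐ ω ∂P, ω ∈ ⋃ n, {ω | w.renewalTime n ω ≤ t ∧ t < w.renewalTime (n + 1) ω} := by
  -- At `u = 0` the flow is zero, and the identity says that the probabilities of exactly `n`
  -- renewals sum to `1`.
  have h := w.tsum_exactTerm_lambert hx hx0 ht (u := fun _ => 0) (fun _ => one_pos)
    (fun _ => by simpa using Real.exp_pos (-1))
  simp only [exactTerm, mul_zero, Finset.sum_const_zero, Real.exp_zero, ENNReal.ofReal_one,
    lintegral_const, Measure.restrict_apply_univ, one_mul, zero_mul, neg_zero, lambertW_zero] at h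
  rw [← measure_iUnion₀ (w.aedisjoint_exact hx hx0 t)
    fun n => (w.measurableSet_exact t n).nullMeasurableSet] at h
  exact (prob_compl_eq_zero_iff (MeasurableSet.iUnion fun n => w.measurableSet_exact t n)).mpr h

theorem restrict_iUnion_exact (w : ContinuumPolyaWalk P (expDiagonalLaw c) x)
    (hx : ∀ i, 0 ≤ x i) (hx0 : x ≠ 0) {t : ℝ} (ht : 0 ≤ t) :
    P.restrict (⋃ n, {ω | w.renewalTime n ω ≤ t ∧ t < w.renewalTime (n + 1) ω}) = P :=
  Measure.restrict_eq_self_of_ae_mem (w.ae_exists_exact hx hx0 ht)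

theorem aemeasurable_X (w : ContinuumPolyaWalk P (expDiagonalLaw c) x)
    (hx : ∀ i, 0 ≤ x i) (hx0 : x ≠ 0) (t : ℝ) : AEMeasurable (w.X t) P := by
  rcases le_or_gt 0 t with ht | ht
  · suffices h : AEMeasurable (w.X t) (P.restrict
        (⋃ n, {ω | w.renewalTime n ω ≤ t ∧ t < w.renewalTime (n + 1) ω})) by
      rwa [w.restrict_iUnion_exact hx hx0 ht] at h
    rw [aemeasurable_iUnion_iff]
    intro n
    refine (w.measurable_pos n).aemeasurable.congr ?_
    rw [EventuallyEq, ae_restrict_iff' (w.measurableSet_exact t n)]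
    filter_upwards [w.ae_strictMono_renewalTime hx hx0] with ω hω h
    exact (w.X_eq_of_exact hω h).symm
  -- For negative `t` almost surely no renewal is counted, so the walk is at `x`.
  · refine (measurable_const (a := x)).aemeasurable.congr ?_
    filter_upwards [w.ae_strictMono_renewalTime hx hx0] with ω hω
    have : {n : ℕ | w.renewalTime (n + 1) ω ≤ t} = ∅ := by
      ext n
      have h := hω.monotone (Nat.zero_le (n + 1))
      simp only [renewalTime_zero] at h
      simp only [Set.mem_ofPred_eq, Set.mem_empty_iff_false, iff_false, not_le]
      linarith
    rw [X, renewalCount, this, Set.ncard_empty]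
    rfl

theorem ae_X_nonneg (w : ContinuumPolyaWalk P (expDiagonalLaw c) x)
    (hx : ∀ i, 0 ≤ x i) (hx0 : x ≠ 0) (t : ℝ) : ∀ᵐ ω ∂P, ∀ i, 0 ≤ w.X t ω i := by
  filter_upwards [ae_all_iff.mpr (w.ae_pos_nonneg hx hx0)] with ω h
  exact (h _).1

/-- The joint moment generating function of the walk at time `t`. -/
theorem lintegral_exp_X (w : ContinuumPolyaWalk P (expDiagonalLaw c) x)
    (hx : ∀ i, 0 ≤ x i) (hx0 : x ≠ 0) {t : ℝ} (ht : 0 ≤ t) {u : Fin c → ℝ} (hu : ∀ i, u i < 1)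
    (h : ∀ i, u i * Real.exp (t - u i) < Real.exp (-1)) :
    ∫⁻ ω, ENNReal.ofReal (Real.exp (∑ i, w.X t ω i * u i)) ∂P =
      ENNReal.ofReal (Real.exp (-∑ i, x i * lambertW (-(u i * Real.exp (t - u i))))) := by
  rw [← w.tsum_exactTerm_lambert hx hx0 ht hu h]
  have hr : ∀ f : Ω → ENNReal, ∫⁻ ω, f ω ∂P = ∫⁻ ω in
      ⋃ n, {ω | w.renewalTime n ω ≤ t ∧ t < w.renewalTime (n + 1) ω}, f ω ∂P := fun f => by
    rw [w.restrict_iUnion_exact hx hx0 ht]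
  rw [hr, lintegral_iUnion₀ (fun n => (w.measurableSet_exact t n).nullMeasurableSet)
    (w.aedisjoint_exact hx hx0 t)]
  refine tsum_congr fun n => ?_
  rw [exactTerm]
  refine setLIntegral_congr_fun_ae (w.measurableSet_exact t n) ?_
  filter_upwards [w.ae_strictMono_renewalTime hx hx0] with ω hω h
  rw [w.X_eq_of_exact hω h]

end ContinuumPolyaWalk

/-! ### The tree function and the scaling of the transform. -/

/-- The defining equation of `W` reads `T s = s * exp (T s)`, so the quotient is `exp (T s)`, a form
that also makes sense at `s = 0`. -/
theorem treeFunction_div_rpow {s : ℝ} (hs : s ≤ Real.exp (-1)) (hs0 : s ≠ 0) (r : ℝ) :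
    (treeFunction s / s) ^ r = Real.exp (r * treeFunction s) := by
  have h := lambertW_mul_exp (neg_le_neg hs)
  have : treeFunction s / s = Real.exp (treeFunction s) := by
    rw [div_eq_iff hs0, treeFunction, Real.exp_neg]
    field_simp
    linarith
  rw [this, ← Real.exp_mul, mul_comm]

theorem treeFunction_zero : treeFunction 0 = 0 := by
  rw [treeFunction, neg_zero, lambertW_zero, neg_zero]

theorem treeFunction_nonpos {s : ℝ} (hs : s ≤ 0) : treeFunction s ≤ 0 := by
  have h1 : -Real.exp (-1) ≤ 0 := neg_nonpos.mpr (Real.exp_pos _).le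
  have h := strictMonoOn_lambertW.monotoneOn (Set.mem_Ici.mpr h1)
    (Set.mem_Ici.mpr (h1.trans (neg_nonneg.mpr hs))) (neg_nonneg.mpr hs)
  rw [lambertW_zero] at h
  exact neg_nonpos.mpr h

theorem continuousOn_treeFunction : ContinuousOn treeFunction (Set.Iic (Real.exp (-1))) := by
  have hm : Set.MapsTo (fun s : ℝ => -s) (Set.Iic (Real.exp (-1))) (Set.Ici (-Real.exp (-1))) :=
    fun _ hs => Set.mem_Ici.mpr (neg_le_neg hs)
  exact (continuousOn_lambertW.comp continuous_neg.continuousOn hm).neg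

theorem integrable_and_integral_eq_of_lintegral {Ω : Type*} [MeasurableSpace Ω] {P : Measure Ω}
    {f : Ω → ℝ} {a : ℝ} (hf : AEStronglyMeasurable f P) (hf0 : 0 ≤ f) (ha : 0 ≤ a)
    (h : ∫⁻ ω, ENNReal.ofReal (f ω) ∂P = ENNReal.ofReal a) :
    Integrable f P ∧ ∫ ω, f ω ∂P = a := by
  constructor
  · rw [← lintegral_ofReal_ne_top_iff_integrable hf (ae_of_all _ hf0), h]
    exact ENNReal.ofReal_ne_top
  · rw [integral_eq_lintegral_of_nonneg_ae (ae_of_all _ hf0) hf, h, ENNReal.toReal_ofReal ha]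

theorem scaled_arg_le {s t : ℝ} (hs : s ≤ Real.exp (-1)) :
    s * Real.exp (-(s * Real.exp (-t))) ≤ Real.exp (-1) := by
  rcases le_total s 0 with h | h
  · exact (mul_nonpos_of_nonpos_of_nonneg h (Real.exp_pos _).le).trans (Real.exp_pos _).le
  · refine (mul_le_of_le_one_right h ?_).trans hs
    rw [Real.exp_le_one_iff]
    exact neg_nonpos.mpr (by positivity)

/-- At `s = 1/e` the limit of the arguments is the end of the domain of `W`, where only continuity
within the domain is available; `scaled_arg_le` keeps the arguments inside. -/
theorem tendsto_lambertW_scaled {s : ℝ} (hs : s ≤ Real.exp (-1)) :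
    Tendsto (fun t : ℝ => lambertW (-(s * Real.exp (-(s * Real.exp (-t)))))) atTop
      (𝓝 (-treeFunction s)) := by
  rw [treeFunction, neg_neg]
  have h1 : Tendsto (fun t : ℝ => -(s * Real.exp (-(s * Real.exp (-t))))) atTop (𝓝 (-s)) := by
    have h2 : Tendsto (fun t : ℝ => Real.exp (-t)) atTop (𝓝 0) :=
      Real.tendsto_exp_neg_atTop_nhds_zero
    have h3 : Continuous fun r : ℝ => -(s * Real.exp (-(s * r))) := by fun_prop
    have h5 := (h3.tendsto 0).comp h2
    rwa [mul_zero, neg_zero, Real.exp_zero, mul_one] at h5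
  have h4 : Tendsto (fun t : ℝ => -(s * Real.exp (-(s * Real.exp (-t))))) atTop
      (𝓝[Set.Ici (-Real.exp (-1))] (-s)) :=
    tendsto_nhdsWithin_iff.mpr ⟨h1, Eventually.of_forall fun t =>
      neg_le_neg (scaled_arg_le hs)⟩
  exact (continuousOn_lambertW (-s) (neg_le_neg hs)).tendsto.comp h4

theorem scaled_mul_exp (s t : ℝ) :
    Real.exp (-t) * s * Real.exp (t - Real.exp (-t) * s) = s * Real.exp (-(s * Real.exp (-t))) := by
  rw [sub_eq_add_neg, Real.exp_add, Real.exp_neg t]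
  field_simp

/-! ### Transforms of one coordinate up to the endpoint, and their limits. -/

namespace ContinuumPolyaWalk

variable {Ω : Type*} [MeasurableSpace Ω] {P : Measure Ω} {c : ℕ} {x : Fin c → ℝ}
  [IsProbabilityMeasure P]

theorem aemeasurable_X_apply (w : ContinuumPolyaWalk P (expDiagonalLaw c) x)
    (hx : ∀ i, 0 ≤ x i) (hx0 : x ≠ 0) (t : ℝ) (i : Fin c) :
    AEMeasurable (fun ω => w.X t ω i) P :=
  (measurable_pi_apply i).comp_aemeasurable (w.aemeasurable_X hx hx0 t)

theorem lintegral_exp_X_apply_of_lt (w : ContinuumPolyaWalk P (expDiagonalLaw c) x)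
    (hx : ∀ i, 0 ≤ x i) (hx0 : x ≠ 0) (i : Fin c) {t u : ℝ} (ht : 0 ≤ t) (hu : u < 1)
    (h : u * Real.exp (t - u) < Real.exp (-1)) :
    ∫⁻ ω, ENNReal.ofReal (Real.exp (u * w.X t ω i)) ∂P =
      ENNReal.ofReal (Real.exp (-(x i * lambertW (-(u * Real.exp (t - u)))))) := by
  have key := w.lintegral_exp_X hx hx0 ht (u := Pi.single i u)
    (fun j => by by_cases hj : j = i
                 · subst hj; simpa using hu
                 · simp [Pi.single_eq_of_ne hj])
    (fun j => by by_cases hj : j = i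
                 · subst hj; simpa using h
                 · simpa [Pi.single_eq_of_ne hj] using Real.exp_pos (-1))
  have h1 : ∑ j, x j * lambertW (-(Pi.single (M := fun _ : Fin c => ℝ) i u j *
      Real.exp (t - Pi.single (M := fun _ : Fin c => ℝ) i u j))) =
      x i * lambertW (-(u * Real.exp (t - u))) := by
    rw [Finset.sum_eq_single i]
    · rw [Pi.single_eq_same]
    · intro j _ hj
      rw [Pi.single_eq_of_ne hj, zero_mul, neg_zero, lambertW_zero, mul_zero]
    · simp
  rw [h1] at key
  rw [← key]
  refine lintegral_congr fun ω => ?_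
  congr 2
  rw [Finset.sum_eq_single i]
  · rw [Pi.single_eq_same, mul_comm]
  · intro j _ hj
    rw [Pi.single_eq_of_ne hj, mul_zero]
  · simp

/-- When `u * exp (t - u) = 1/e` no larger flow is available. Instead `u` is approached from below:
since `X ≥ 0`, monotone convergence applies on the left, and continuity of `W` within its domain on
the right. -/
theorem lintegral_exp_X_apply (w : ContinuumPolyaWalk P (expDiagonalLaw c) x)
    (hx : ∀ i, 0 ≤ x i) (hx0 : x ≠ 0) (i : Fin c) {t u : ℝ} (ht : 0 ≤ t) (hu : u < 1)
    (h : u * Real.exp (t - u) ≤ Real.exp (-1)) :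
    ∫⁻ ω, ENNReal.ofReal (Real.exp (u * w.X t ω i)) ∂P =
      ENNReal.ofReal (Real.exp (-(x i * lambertW (-(u * Real.exp (t - u)))))) := by
  let r : ℕ → ℝ := fun n => u - 1 / ((n : ℝ) + 1)
  have hr : ∀ n, r n < u := fun n => sub_lt_self _ (by positivity)
  have hr' : ∀ n, r n * Real.exp (t - r n) < Real.exp (-1) := fun n =>
    (mul_exp_sub_lt (hr n) hu.le).trans_le h
  have hrlim : Tendsto r atTop (𝓝 u) := by
    have := (tendsto_one_div_add_atTop_nhds_zero_nat (𝕜 := ℝ)).const_sub u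
    rwa [sub_zero] at this
  have hrmono : Monotone r := fun m n hmn =>
    sub_le_sub_left (one_div_le_one_div_of_le (by positivity) (by gcongr)) _
  have hXm := w.aemeasurable_X_apply hx hx0 t i
  have h1 : Tendsto (fun n => ∫⁻ ω, ENNReal.ofReal (Real.exp (r n * w.X t ω i)) ∂P) atTop
      (𝓝 (∫⁻ ω, ENNReal.ofReal (Real.exp (u * w.X t ω i)) ∂P)) := by
    refine lintegral_tendsto_of_tendsto_of_monotone (fun n => by fun_prop) ?_ ?_
    · filter_upwards [w.ae_X_nonneg hx hx0 t] with ω hω m n hmn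
      exact ENNReal.ofReal_le_ofReal (Real.exp_le_exp.mpr
        (mul_le_mul_of_nonneg_right (hrmono hmn) (hω i)))
    · refine ae_of_all _ fun ω => ?_
      have hc : Continuous fun r : ℝ => ENNReal.ofReal (Real.exp (r * w.X t ω i)) :=
        ENNReal.continuous_ofReal.comp (by fun_prop)
      exact (hc.tendsto u).comp hrlim
  have h2 : Tendsto (fun n => ENNReal.ofReal
      (Real.exp (-(x i * lambertW (-(r n * Real.exp (t - r n))))))) atTop
      (𝓝 (ENNReal.ofReal (Real.exp (-(x i * lambertW (-(u * Real.exp (t - u)))))))) := by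
    have harg : Tendsto (fun n => -(r n * Real.exp (t - r n))) atTop
        (𝓝[Set.Ici (-Real.exp (-1))] (-(u * Real.exp (t - u)))) := by
      refine tendsto_nhdsWithin_iff.mpr ⟨?_, Eventually.of_forall fun n => neg_le_neg (hr' n).le⟩
      have hc : Continuous fun r : ℝ => -(r * Real.exp (t - r)) := by fun_prop
      exact (hc.tendsto u).comp hrlim
    have hW := (continuousOn_lambertW _ (neg_le_neg h)).tendsto.comp harg
    have hc : Continuous fun y : ℝ => ENNReal.ofReal (Real.exp (-(x i * y))) :=
      ENNReal.continuous_ofReal.comp (by fun_prop)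
    exact (hc.tendsto _).comp hW
  refine tendsto_nhds_unique h1 (h2.congr fun n => ?_)
  exact (w.lintegral_exp_X_apply_of_lt hx hx0 i ht ((hr n).trans hu) (hr' n)).symm

theorem integrable_and_mgf_X (w : ContinuumPolyaWalk P (expDiagonalLaw c) x)
    (hx : ∀ i, 0 ≤ x i) (hx0 : x ≠ 0) (i : Fin c) {t u : ℝ} (ht : 0 ≤ t) (hu : u < 1)
    (h : u * Real.exp (t - u) ≤ Real.exp (-1)) :
    Integrable (fun ω => Real.exp (u * w.X t ω i)) P ∧
      mgf (fun ω => w.X t ω i) P u =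
        Real.exp (-(x i * lambertW (-(u * Real.exp (t - u))))) := by
  have hXm := w.aemeasurable_X_apply hx hx0 t i
  exact integrable_and_integral_eq_of_lintegral
    (AEMeasurable.aestronglyMeasurable (by fun_prop)) (fun _ => (Real.exp_pos _).le)
    (Real.exp_pos _).le (w.lintegral_exp_X_apply hx hx0 i ht hu h)

theorem integrable_and_integral_exp_scaled (w : ContinuumPolyaWalk P (expDiagonalLaw c) x)
    (hx : ∀ i, 0 ≤ x i) (hx0 : x ≠ 0) (i : Fin c) {t s : ℝ} (ht : 0 ≤ t)
    (hs : s ≤ Real.exp (-1)) :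
    Integrable (fun ω => Real.exp (s * (Real.exp (-t) * w.X t ω i))) P ∧
      ∫ ω, Real.exp (s * (Real.exp (-t) * w.X t ω i)) ∂P =
        Real.exp (-(x i * lambertW (-(s * Real.exp (-(s * Real.exp (-t))))))) := by
  have h1 : Real.exp (-t) * s < 1 := by
    have h2 : Real.exp (-t) ≤ 1 := Real.exp_le_one_iff.mpr (neg_nonpos.mpr ht)
    have h3 : Real.exp (-1) < 1 := by
      rw [← Real.exp_zero, Real.exp_lt_exp]; norm_num
    nlinarith [Real.exp_pos (-t)]
  have h := w.integrable_and_mgf_X hx hx0 i ht h1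
    (by rw [scaled_mul_exp]; exact scaled_arg_le hs)
  rw [scaled_mul_exp, mgf] at h
  have h4 : ∀ ω, Real.exp (-t) * s * w.X t ω i = s * (Real.exp (-t) * w.X t ω i) :=
    fun ω => by ring
  simpa only [h4] using h

theorem tendsto_integral_exp_scaled (w : ContinuumPolyaWalk P (expDiagonalLaw c) x)
    (hx : ∀ i, 0 ≤ x i) (hx0 : x ≠ 0) (i : Fin c) {s : ℝ} (hs : s ≤ Real.exp (-1)) :
    Tendsto (fun t : ℝ => ∫ ω, Real.exp (s * (Real.exp (-t) * w.X t ω i)) ∂P) atTop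
      (𝓝 (Real.exp (x i * treeFunction s))) := by
  have hc : Continuous fun y : ℝ => Real.exp (-(x i * y)) := by fun_prop
  have h := (hc.tendsto _).comp (tendsto_lambertW_scaled hs)
  rw [mul_neg, neg_neg] at h
  refine h.congr' ?_
  filter_upwards [eventually_ge_atTop 0] with t ht
  exact (w.integrable_and_integral_exp_scaled hx hx0 i ht hs).2.symm

/-- For nonpositive `s` the admissibility conditions hold automatically, and these values suffice
for Laplace transforms. -/
theorem tendsto_integral_exp_sum_scaled (w : ContinuumPolyaWalk P (expDiagonalLaw c) x)
    (hx : ∀ i, 0 ≤ x i) (hx0 : x ≠ 0) {s : Fin c → ℝ} (hs : ∀ i, s i ≤ 0) :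
    Tendsto (fun t : ℝ => ∫ ω, Real.exp (∑ i, s i * (Real.exp (-t) * w.X t ω i)) ∂P) atTop
      (𝓝 (Real.exp (∑ i, x i * treeFunction (s i)))) := by
  have hs' : ∀ i, s i ≤ Real.exp (-1) := fun i => (hs i).trans (Real.exp_pos _).le
  have hW : Tendsto (fun t : ℝ => Real.exp
      (-∑ i, x i * lambertW (-(s i * Real.exp (-(s i * Real.exp (-t))))))) atTop
      (𝓝 (Real.exp (∑ i, x i * treeFunction (s i)))) := by
    have h1 := tendsto_finsetSum Finset.univ
      fun i _ => (tendsto_lambertW_scaled (hs' i)).const_mul (x i)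
    have h2 := (Real.continuous_exp.tendsto _).comp h1.neg
    simp only [mul_neg, Finset.sum_neg_distrib, neg_neg] at h2
    exact h2
  refine hW.congr' ?_
  filter_upwards [eventually_ge_atTop 0] with t ht
  have hn : ∀ i, Real.exp (-t) * s i ≤ 0 := fun i =>
    mul_nonpos_of_nonneg_of_nonpos (Real.exp_pos _).le (hs i)
  have h := w.lintegral_exp_X hx hx0 ht (u := fun i => Real.exp (-t) * s i)
    (fun i => (hn i).trans_lt one_pos)
    (fun i => (mul_nonpos_of_nonpos_of_nonneg (hn i) (Real.exp_pos _).le).trans_lt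
      (Real.exp_pos _))
  simp only [scaled_mul_exp] at h
  have hXm := w.aemeasurable_X_apply hx hx0 t
  have h2 := (integrable_and_integral_eq_of_lintegral
    (AEMeasurable.aestronglyMeasurable (by fun_prop)) (fun _ => (Real.exp_pos _).le)
    (Real.exp_pos _).le h).2
  rw [← h2]
  refine integral_congr_ae (ae_of_all _ fun ω => ?_)
  simp only
  congr 1
  exact Finset.sum_congr rfl fun i _ => by ring

end ContinuumPolyaWalk

/-! ### Weak convergence through exponential transforms. -/

/-- Where `y ≥ R`, both `s y` and `s R` are at most `b y - (b - s) R`. For `s < b` this makes the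
truncation error small uniformly over laws with a bounded exponential moment at `b`. -/
theorem abs_exp_mul_sub_exp_mul_min_le {s b y R : ℝ} (hsb : s ≤ b) (hb : 0 ≤ b) :
    |Real.exp (s * y) - Real.exp (s * min y R)| ≤
      Real.exp (-((b - s) * R)) * Real.exp (b * y) := by
  rcases le_total y R with h | h
  · rw [min_eq_left h, sub_self, abs_zero]
    positivity
  rw [min_eq_right h, ← Real.exp_add]
  have h1 : Real.exp (s * y) ≤ Real.exp (-((b - s) * R) + b * y) := by
    rw [Real.exp_le_exp]; nlinarith [mul_le_mul_of_nonneg_left h (sub_nonneg.mpr hsb)]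
  have h2 : Real.exp (s * R) ≤ Real.exp (-((b - s) * R) + b * y) := by
    rw [Real.exp_le_exp]; nlinarith [mul_le_mul_of_nonneg_left h hb]
  rw [abs_le]
  constructor <;> linarith [Real.exp_pos (s * y), Real.exp_pos (s * R)]

/-- Moment generating functions converge along weakly convergent laws of nonnegative variables, up
to and including the right end point of an interval where they converge. -/
theorem integrable_and_integral_exp_of_tendsto {E ι : Type*} [TopologicalSpace E]
    [MeasurableSpace E] [OpensMeasurableSpace E] {l : Filter ι} [NeBot l]
    {μ : ι → ProbabilityMeasure E} {μ₀ : ProbabilityMeasure E} (hμ : Tendsto μ l (𝓝 μ₀))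
    {y : E → ℝ} (hyc : Continuous y) (hy : ∀ e, 0 ≤ y e) {b : ℝ} (hb : 0 < b) {L : ℝ → ℝ}
    (hint : ∀ n, ∀ s ≤ b, Integrable (fun e => Real.exp (s * y e)) (μ n : Measure E))
    (hL : ∀ s ≤ b, Tendsto (fun n => ∫ e, Real.exp (s * y e) ∂(μ n : Measure E)) l (𝓝 (L s)))
    (hLc : ContinuousWithinAt L (Set.Iio b) b) {s : ℝ} (hs : s ≤ b) :
    Integrable (fun e => Real.exp (s * y e)) (μ₀ : Measure E) ∧
      ∫ e, Real.exp (s * y e) ∂(μ₀ : Measure E) = L s := by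
  have hym : Measurable y := hyc.measurable
  have hbdd : ∀ s R : ℝ, 0 ≤ R → ∀ e, Real.exp (s * min (y e) R) ≤ Real.exp (|s| * R) := by
    intro s R hR e
    rw [Real.exp_le_exp]
    calc s * min (y e) R ≤ |s| * min (y e) R :=
          mul_le_mul_of_nonneg_right (le_abs_self s) (le_min (hy e) hR)
      _ ≤ |s| * R := mul_le_mul_of_nonneg_left (min_le_right _ _) (abs_nonneg s)
  have htrint : ∀ (ν : ProbabilityMeasure E) (s R : ℝ), 0 ≤ R →
      Integrable (fun e => Real.exp (s * min (y e) R)) (ν : Measure E) := fun ν s R hR =>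
    Integrable.of_bound (by fun_prop) (Real.exp (|s| * R)) (ae_of_all _ fun e => by
      rw [Real.norm_of_nonneg (Real.exp_pos _).le]
      exact hbdd s R hR e)
  have htr : ∀ s R : ℝ, 0 ≤ R →
      Tendsto (fun n => ∫ e, Real.exp (s * min (y e) R) ∂(μ n : Measure E)) l
        (𝓝 (∫ e, Real.exp (s * min (y e) R) ∂(μ₀ : Measure E))) := by
    intro s R hR
    let f : E →ᵇ ℝ := BoundedContinuousFunction.ofNormedAddCommGroup
      (fun e => Real.exp (s * min (y e) R)) (by fun_prop) (Real.exp (|s| * R)) fun e => by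
        rw [Real.norm_of_nonneg (Real.exp_pos _).le]
        exact hbdd s R hR e
    exact (ProbabilityMeasure.tendsto_iff_forall_integral_tendsto.mp hμ) f
  -- Truncated exponentials are bounded and continuous, so they pass to the weak limit; letting `R`
  -- grow then bounds the exponential moment at `b`.
  have hupper : ∀ R : ℝ, 0 ≤ R → ∫ e, Real.exp (b * min (y e) R) ∂(μ₀ : Measure E) ≤ L b := by
    intro R hR
    refine le_of_tendsto_of_tendsto' (htr b R hR) (hL b le_rfl) fun n => ?_
    refine integral_mono (htrint _ _ _ hR) (hint n b le_rfl) fun e => ?_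
    exact Real.exp_le_exp.mpr (mul_le_mul_of_nonneg_left (min_le_left _ _) hb.le)
  have hLb : 0 ≤ L b := (integral_nonneg fun _ => (Real.exp_pos _).le).trans (hupper 0 le_rfl)
  have hlint : ∫⁻ e, ENNReal.ofReal (Real.exp (b * y e)) ∂(μ₀ : Measure E) ≤
      ENNReal.ofReal (L b) := by
    have h1 : Tendsto (fun k : ℕ => ∫⁻ e, ENNReal.ofReal (Real.exp (b * min (y e) k))
        ∂(μ₀ : Measure E)) atTop (𝓝 (∫⁻ e, ENNReal.ofReal (Real.exp (b * y e))
          ∂(μ₀ : Measure E))) := by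
      refine lintegral_tendsto_of_tendsto_of_monotone (fun k => by fun_prop) ?_ ?_
      · refine ae_of_all _ fun e m k hmk => ENNReal.ofReal_le_ofReal (Real.exp_le_exp.mpr ?_)
        exact mul_le_mul_of_nonneg_left (min_le_min_left _ (by exact_mod_cast hmk)) hb.le
      · refine ae_of_all _ fun e => tendsto_const_nhds.congr' ?_
        obtain ⟨N, hN⟩ := exists_nat_ge (y e)
        filter_upwards [eventually_ge_atTop N] with k hk
        rw [min_eq_left (hN.trans (by exact_mod_cast hk))]
    refine le_of_tendsto' h1 fun k => ?_
    rw [← ofReal_integral_eq_lintegral_ofReal (htrint _ _ _ k.cast_nonneg)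
      (ae_of_all _ fun _ => (Real.exp_pos _).le)]
    exact ENNReal.ofReal_le_ofReal (hupper _ k.cast_nonneg)
  have hintb : Integrable (fun e => Real.exp (b * y e)) (μ₀ : Measure E) := by
    rw [← lintegral_ofReal_ne_top_iff_integrable (by fun_prop)
      (ae_of_all _ fun _ => (Real.exp_pos _).le)]
    exact ne_top_of_le_ne_top ENNReal.ofReal_ne_top hlint
  have hintb_le : ∫ e, Real.exp (b * y e) ∂(μ₀ : Measure E) ≤ L b := by
    rw [← ofReal_integral_eq_lintegral_ofReal hintb (ae_of_all _ fun _ => (Real.exp_pos _).le)]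
      at hlint
    exact (ENNReal.ofReal_le_ofReal_iff hLb).mp hlint
  have hints : ∀ s ≤ b, Integrable (fun e => Real.exp (s * y e)) (μ₀ : Measure E) := fun s hs =>
    hintb.mono' (by fun_prop) (ae_of_all _ fun e => by
      rw [Real.norm_of_nonneg (Real.exp_pos _).le]
      exact Real.exp_le_exp.mpr (mul_le_mul_of_nonneg_right hs (hy e)))
  have hdiff : ∀ (ν : ProbabilityMeasure E), (∀ s ≤ b, Integrable (fun e => Real.exp (s * y e))
      (ν : Measure E)) → ∀ s ≤ b, ∀ R : ℝ, 0 ≤ R →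
      |∫ e, Real.exp (s * y e) ∂(ν : Measure E) - ∫ e, Real.exp (s * min (y e) R) ∂(ν : Measure E)|
        ≤ Real.exp (-((b - s) * R)) * ∫ e, Real.exp (b * y e) ∂(ν : Measure E) := by
    intro ν hν s hs R hR
    rw [← integral_sub (hν s hs) (htrint _ _ _ hR), ← integral_const_mul]
    refine (abs_integral_le_integral_abs).trans (integral_mono ?_ ((hν b le_rfl).const_mul _)
      fun e => abs_exp_mul_sub_exp_mul_min_le hs hb.le)
    exact ((hν s hs).sub (htrint _ _ _ hR)).abs
  have hlt : ∀ s < b, ∫ e, Real.exp (s * y e) ∂(μ₀ : Measure E) = L s := by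
    intro s hs
    have h1 : ∀ R : ℝ, 0 ≤ R → |∫ e, Real.exp (s * y e) ∂(μ₀ : Measure E) - L s| ≤
        2 * L b * Real.exp (-((b - s) * R)) := by
      intro R hR
      have h2 := (hdiff μ₀ hints s hs.le R hR).trans
        (mul_le_mul_of_nonneg_left hintb_le (Real.exp_pos _).le)
      have h3 : |L s - ∫ e, Real.exp (s * min (y e) R) ∂(μ₀ : Measure E)| ≤
          Real.exp (-((b - s) * R)) * L b :=
        le_of_tendsto_of_tendsto' ((hL s hs.le).sub (htr s R hR)).abs
          ((hL b le_rfl).const_mul _) fun n => hdiff (μ n) (hint n) s hs.le R hR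
      rw [abs_le] at h2 h3 ⊢
      constructor <;> linarith
    have h4 : Tendsto (fun R : ℝ => 2 * L b * Real.exp (-((b - s) * R))) atTop (𝓝 0) := by
      have h5 : Tendsto (fun R : ℝ => (b - s) * R) atTop atTop :=
        tendsto_id.const_mul_atTop (sub_pos.mpr hs)
      simpa using (Real.tendsto_exp_neg_atTop_nhds_zero.comp h5).const_mul (2 * L b)
    have h6 := ge_of_tendsto h4 ((eventually_ge_atTop 0).mono h1)
    exact sub_eq_zero.mp (abs_nonpos_iff.mp h6)
  refine ⟨hints s hs, ?_⟩
  -- At `s = b` truncation gives only `≤`. The reverse bound compares `L r`, the integral at `r <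
  -- b`, with the integral at `b` and uses left continuity of `L`.
  rcases eq_or_lt_of_le hs with rfl | hs
  · refine le_antisymm hintb_le (le_of_tendsto hLc ?_)
    filter_upwards [self_mem_nhdsWithin] with r hr
    rw [← hlt r hr]
    refine integral_mono (hints r (le_of_lt hr)) hintb fun e => ?_
    exact Real.exp_le_exp.mpr (mul_le_mul_of_nonneg_right (le_of_lt hr) (hy e))
  · exact hlt s hs

/-- The bounded continuous function `y ↦ exp (-∑ i, k i * y i)` on the orthant. -/
noncomputable def expNegSum {c : ℕ} (k : Fin c → ℕ) : (Fin c → ℝ≥0) →ᵇ ℝ :=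
  BoundedContinuousFunction.ofNormedAddCommGroup
    (fun y => Real.exp (-∑ i, (k i : ℝ) * (y i : ℝ))) (by fun_prop) 1 fun y => by
      rw [Real.norm_of_nonneg (Real.exp_pos _).le, Real.exp_le_one_iff, neg_nonpos]
      positivity

theorem expNegSum_apply {c : ℕ} (k : Fin c → ℕ) (y : Fin c → ℝ≥0) :
    expNegSum k y = Real.exp (-∑ i, (k i : ℝ) * (y i : ℝ)) := rfl

/-- The exponentials `expNegSum k` as a submonoid. -/
noncomputable def expNegSumSubmonoid (c : ℕ) : Submonoid ((Fin c → ℝ≥0) →ᵇ ℝ) where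
  carrier := Set.range expNegSum
  one_mem' := ⟨0, by ext y; simp [expNegSum_apply]⟩
  mul_mem' := by
    rintro _ _ ⟨k, rfl⟩ ⟨l, rfl⟩
    refine ⟨k + l, ?_⟩
    ext y
    rw [BoundedContinuousFunction.mul_apply, expNegSum_apply, expNegSum_apply, expNegSum_apply,
      ← Real.exp_add, ← neg_add, ← Finset.sum_add_distrib]
    simp [add_mul]

/-- The algebra spanned by the exponentials `expNegSum k`. -/
noncomputable def expNegSumAlgebra (c : ℕ) : StarSubalgebra ℝ ((Fin c → ℝ≥0) →ᵇ ℝ) where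
  toSubalgebra := Algebra.adjoin ℝ (expNegSumSubmonoid c : Set ((Fin c → ℝ≥0) →ᵇ ℝ))
  star_mem' := by
    intro f hf
    have : star f = f := by ext y; simp
    rwa [this]

theorem separatesPoints_expNegSumAlgebra (c : ℕ) :
    ((expNegSumAlgebra c).map
      (BoundedContinuousFunction.toContinuousMapStarₐ ℝ)).SeparatesPoints := by
  intro y z hyz
  obtain ⟨i, hi⟩ := Function.ne_iff.mp hyz
  refine ⟨expNegSum (Pi.single i 1), ⟨BoundedContinuousFunction.toContinuousMapStarₐ ℝ
    (expNegSum (Pi.single i 1)), ⟨expNegSum (Pi.single i 1), ?_, rfl⟩, rfl⟩, ?_⟩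
  · exact Algebra.subset_adjoin ⟨_, rfl⟩
  · intro h
    rw [expNegSum_apply, expNegSum_apply] at h
    have hs : ∀ y : Fin c → ℝ≥0,
        ∑ j, ((Pi.single (M := fun _ : Fin c => ℕ) i 1 j : ℕ) : ℝ) * (y j : ℝ) = y i := by
      intro y
      rw [Finset.sum_eq_single i]
      · simp
      · intro j _ hj
        simp [Pi.single_eq_of_ne hj]
      · simp
    rw [hs, hs] at h
    exact hi (NNReal.coe_injective (neg_injective (Real.exp_injective h)))

/-- Convergence of the multivariate Laplace transform at integer points implies weak convergence of
a tight family of laws on the orthant. -/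
theorem tendsto_of_tight_of_tendsto_laplace {c : ℕ} {ι : Type*} {l : Filter ι}
    {μ : ι → ProbabilityMeasure (Fin c → ℝ≥0)} {μ₀ : ProbabilityMeasure (Fin c → ℝ≥0)}
    (htight : IsTightMeasureSet {(μ n : Measure (Fin c → ℝ≥0)) | n})
    (h : ∀ k : Fin c → ℕ, Tendsto (fun n => ∫ y, expNegSum k y ∂(μ n : Measure (Fin c → ℝ≥0))) l
      (𝓝 (∫ y, expNegSum k y ∂(μ₀ : Measure (Fin c → ℝ≥0))))) :
    Tendsto μ l (𝓝 μ₀) := by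
  refine ProbabilityMeasure.tendsto_of_tight_of_separatesPoints ℝ htight
    (separatesPoints_expNegSumAlgebra c) fun g hg => ?_
  -- The exponentials are closed under products, so the algebra is their linear span and convergence
  -- need only be checked on them.
  have hg' : g ∈ Submodule.span ℝ (expNegSumSubmonoid c : Set ((Fin c → ℝ≥0) →ᵇ ℝ)) := by
    have h1 : g ∈ Subalgebra.toSubmodule
      (Algebra.adjoin ℝ (expNegSumSubmonoid c : Set ((Fin c → ℝ≥0) →ᵇ ℝ))) := hg
    rwa [Algebra.adjoin_eq_span, Submonoid.closure_eq] at h1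
  have hi : ∀ (ν : ProbabilityMeasure (Fin c → ℝ≥0)) (f : (Fin c → ℝ≥0) →ᵇ ℝ),
      Integrable f (ν : Measure (Fin c → ℝ≥0)) := fun ν f => f.integrable _
  clear hg
  induction hg' using Submodule.span_induction with
  | mem g hg => obtain ⟨k, rfl⟩ := hg; exact h k
  | zero =>
    simp only [BoundedContinuousFunction.coe_zero, Pi.zero_apply, integral_zero]
    exact tendsto_const_nhds
  | add f g _ _ hf hg =>
    simp only [BoundedContinuousFunction.add_apply]
    simp only [integral_add (hi _ f) (hi _ g)]
    exact hf.add hg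
  | smul a f _ hf =>
    simp only [BoundedContinuousFunction.smul_apply, integral_smul]
    exact hf.const_smul a

/-- A uniform exponential moment bound on every coordinate gives tightness on the orthant. -/
theorem isTightMeasureSet_of_lintegral_exp_le {c : ℕ} {S : Set (Measure (Fin c → ℝ≥0))}
    {b : ℝ} (hb : 0 < b) {C : Fin c → ENNReal} (hC : ∀ i, C i ≠ ⊤)
    (h : ∀ μ ∈ S, ∀ i, ∫⁻ y, ENNReal.ofReal (Real.exp (b * (y i : ℝ))) ∂μ ≤ C i) :
    IsTightMeasureSet S := by
  rw [isTightMeasureSet_iff_exists_isCompact_measure_compl_le]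
  intro ε hε
  have hlim : Tendsto (fun R : ℝ≥0 => (∑ i, C i) * ENNReal.ofReal (Real.exp (-(b * R)))) atTop
      (𝓝 0) := by
    have h1 : Tendsto (fun R : ℝ≥0 => b * (R : ℝ)) atTop atTop :=
      (NNReal.tendsto_coe_atTop.mpr tendsto_id).const_mul_atTop hb
    have h2 := ENNReal.tendsto_ofReal (Real.tendsto_exp_neg_atTop_nhds_zero.comp h1)
    rw [ENNReal.ofReal_zero] at h2
    have h3 := ENNReal.Tendsto.const_mul (a := ∑ i, C i) h2
      (Or.inr (ENNReal.sum_ne_top.mpr fun i _ => hC i))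
    rwa [mul_zero] at h3
  obtain ⟨R, hR⟩ := ((ENNReal.tendsto_nhds_zero.mp hlim) ε hε).exists
  refine ⟨Set.pi Set.univ fun _ => Set.Icc 0 R, isCompact_univ_pi fun _ => isCompact_Icc,
    fun μ hμ => le_trans ?_ hR⟩
  -- Outside the box some coordinate exceeds `R`; Markov's inequality is applied to each.
  have hsub : (Set.pi Set.univ fun _ : Fin c => Set.Icc (0 : ℝ≥0) R)ᶜ ⊆
      ⋃ i, {y : Fin c → ℝ≥0 | ENNReal.ofReal (Real.exp (b * R)) ≤
        ENNReal.ofReal (Real.exp (b * (y i : ℝ)))} := by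
    intro y hy
    simp only [Set.mem_compl_iff, Set.mem_pi, Set.mem_univ, true_imp_iff, Set.mem_Icc, zero_le,
      true_and, not_forall, not_le] at hy
    obtain ⟨i, hi⟩ := hy
    refine Set.mem_iUnion.mpr ⟨i, ENNReal.ofReal_le_ofReal (Real.exp_le_exp.mpr ?_)⟩
    exact mul_le_mul_of_nonneg_left (by exact_mod_cast hi.le) hb.le
  refine (measure_mono hsub).trans ((measure_iUnion_fintype_le _ _).trans ?_)
  rw [Finset.sum_mul]
  refine Finset.sum_le_sum fun i _ => ?_
  have h1 := mul_meas_ge_le_lintegral (μ := μ)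
    (f := fun y : Fin c → ℝ≥0 => ENNReal.ofReal (Real.exp (b * (y i : ℝ)))) (by fun_prop)
    (ENNReal.ofReal (Real.exp (b * R)))
  rw [Real.exp_neg, ENNReal.ofReal_inv_of_pos (Real.exp_pos _), ← div_eq_mul_inv,
    ENNReal.le_div_iff_mul_le (Or.inl (by simp [Real.exp_pos])) (Or.inl ENNReal.ofReal_ne_top),
    mul_comm]
  exact h1.trans (h μ hμ i)

/-! ### Lambert random variables. -/

theorem IsLambert.integrable_and_mgf {Ω : Type*} [MeasurableSpace Ω] {Z : Ω → ℝ} {P : Measure Ω}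
    [IsProbabilityMeasure P] {r : ℝ} (h : IsLambert Z P r) {s : ℝ} (hs : s ≤ Real.exp (-1)) :
    Integrable (fun ω => Real.exp (s * Z ω)) P ∧ mgf Z P s = Real.exp (r * treeFunction s) := by
  rcases eq_or_ne s 0 with rfl | hs0
  · simp [treeFunction_zero]
  · rw [← treeFunction_div_rpow hs hs0]
    exact h.2 s hs hs0

/-- Chernoff's bound at `-a` gives `P (Z ≤ -ε) ≤ exp (-ε a) * exp (r * T (-a))`, and `T (-a) ≤ 0`;
let `a` tend to infinity. This allows the limit to be placed on the orthant. -/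
theorem IsLambert.ae_nonneg {Ω : Type*} [MeasurableSpace Ω] {Z : Ω → ℝ} {P : Measure Ω}
    [IsProbabilityMeasure P] {r : ℝ} (h : IsLambert Z P r) (hr : 0 ≤ r) : ∀ᵐ ω ∂P, 0 ≤ Z ω := by
  have key : ∀ ε : ℝ, 0 < ε → P {ω | Z ω ≤ -ε} = 0 := by
    intro ε hε
    have hle : ∀ a : ℝ, 0 ≤ a → P.real {ω | Z ω ≤ -ε} ≤ Real.exp (-(ε * a)) := by
      intro a ha
      have hna : -a ≤ 0 := neg_nonpos.mpr ha
      obtain ⟨hi, hm⟩ := h.integrable_and_mgf (hna.trans (Real.exp_pos (-1)).le)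
      refine (measure_le_le_exp_mul_mgf (-ε) hna hi).trans ?_
      rw [hm, ← Real.exp_add, Real.exp_le_exp]
      nlinarith [mul_nonpos_of_nonneg_of_nonpos hr (treeFunction_nonpos hna)]
    have hlim : Tendsto (fun a : ℝ => Real.exp (-(ε * a))) atTop (𝓝 0) :=
      Real.tendsto_exp_neg_atTop_nhds_zero.comp (tendsto_id.const_mul_atTop hε)
    have h0 := ge_of_tendsto hlim ((eventually_ge_atTop 0).mono hle)
    exact (measureReal_eq_zero_iff).mp (le_antisymm h0 measureReal_nonneg)
  have hall : ∀ n : ℕ, ∀ᵐ ω ∂P, -(1 / ((n : ℝ) + 1)) < Z ω := fun n => by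
    rw [ae_iff]
    simpa only [not_lt] using key (1 / ((n : ℝ) + 1)) (by positivity)
  filter_upwards [ae_all_iff.mpr hall] with ω hω
  have hlim := (tendsto_one_div_add_atTop_nhds_zero_nat (𝕜 := ℝ)).neg
  rw [neg_zero] at hlim
  exact le_of_tendsto' hlim fun n => (hω n).le

theorem integral_exp_sum_of_isLambert {Ω : Type*} [MeasurableSpace Ω] {P : Measure Ω}
    [IsProbabilityMeasure P] {c : ℕ} {x : Fin c → ℝ} {W : Fin c → Ω → ℝ}
    (hW : ∀ i, IsLambert (W i) P (x i)) (hind : iIndepFun W P) {s : Fin c → ℝ}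
    (hs : ∀ i, s i ≤ Real.exp (-1)) :
    ∫ ω, Real.exp (∑ i, s i * W i ω) ∂P = Real.exp (∑ i, x i * treeFunction (s i)) := by
  have hWm : ∀ i, AEMeasurable (W i) P := fun i => (hW i).1
  simp only [Real.exp_sum]
  have hind' : iIndepFun (fun i ω => Real.exp (s i * W i ω)) P :=
    hind.comp (fun i y => Real.exp (s i * y)) fun i => by fun_prop
  rw [hind'.integral_fun_prod_eq_prod_integral fun i =>
    AEMeasurable.aestronglyMeasurable (by fun_prop)]
  exact Finset.prod_congr rfl fun i _ => ((hW i).integrable_and_mgf (hs i)).2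

/-! ### Tightness, existence of the limit law, and convergence in distribution. -/

namespace ContinuumPolyaWalk

variable {Ω : Type*} [MeasurableSpace Ω] {P : Measure Ω} {c : ℕ} {x : Fin c → ℝ}

/-- The rescaled position `exp (-t) • X t`, as a point of the orthant. -/
noncomputable def scaled (w : ContinuumPolyaWalk P (expDiagonalLaw c) x) (t : ℝ) (ω : Ω) :
    Fin c → ℝ≥0 := fun i => (Real.exp (-t) * w.X t ω i).toNNReal

variable [IsProbabilityMeasure P]

theorem aemeasurable_scaled (w : ContinuumPolyaWalk P (expDiagonalLaw c) x)
    (hx : ∀ i, 0 ≤ x i) (hx0 : x ≠ 0) (t : ℝ) : AEMeasurable (w.scaled t) P := by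
  refine aemeasurable_pi_iff.mpr fun i => ?_
  exact ((w.aemeasurable_X_apply hx hx0 t i).const_mul _).real_toNNReal

theorem ae_coe_scaled (w : ContinuumPolyaWalk P (expDiagonalLaw c) x)
    (hx : ∀ i, 0 ≤ x i) (hx0 : x ≠ 0) (t : ℝ) :
    ∀ᵐ ω ∂P, ∀ i, (w.scaled t ω i : ℝ) = Real.exp (-t) * w.X t ω i := by
  filter_upwards [w.ae_X_nonneg hx hx0 t] with ω hω i
  exact Real.coe_toNNReal _ (mul_nonneg (Real.exp_pos _).le (hω i))

/-- The law of the rescaled position at time `t`. -/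
noncomputable def scaledLaw (w : ContinuumPolyaWalk P (expDiagonalLaw c) x)
    (hx : ∀ i, 0 ≤ x i) (hx0 : x ≠ 0) (t : ℝ) : ProbabilityMeasure (Fin c → ℝ≥0) :=
  ⟨P.map (w.scaled t), Measure.isProbabilityMeasure_map (w.aemeasurable_scaled hx hx0 t)⟩

theorem integrable_and_integral_scaledLaw (w : ContinuumPolyaWalk P (expDiagonalLaw c) x)
    (hx : ∀ i, 0 ≤ x i) (hx0 : x ≠ 0) (i : Fin c) {t s : ℝ} (ht : 0 ≤ t)
    (hs : s ≤ Real.exp (-1)) :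
    Integrable (fun y : Fin c → ℝ≥0 => Real.exp (s * (y i : ℝ)))
        (w.scaledLaw hx hx0 t : Measure (Fin c → ℝ≥0)) ∧
      ∫ y, Real.exp (s * (y i : ℝ)) ∂(w.scaledLaw hx hx0 t : Measure (Fin c → ℝ≥0)) =
        ∫ ω, Real.exp (s * (Real.exp (-t) * w.X t ω i)) ∂P := by
  have hm := w.aemeasurable_scaled hx hx0 t
  have hae : (fun ω => Real.exp (s * (w.scaled t ω i : ℝ))) =ᵐ[P]
      fun ω => Real.exp (s * (Real.exp (-t) * w.X t ω i)) := by
    filter_upwards [w.ae_coe_scaled hx hx0 t] with ω hω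
    rw [hω]
  have hmeas : Measurable fun y : Fin c → ℝ≥0 => Real.exp (s * (y i : ℝ)) := by fun_prop
  simp only [scaledLaw, ProbabilityMeasure.coe_mk]
  constructor
  · rw [integrable_map_measure hmeas.aestronglyMeasurable hm]
    exact (w.integrable_and_integral_exp_scaled hx hx0 i ht hs).1.congr hae.symm
  · rw [integral_map hm hmeas.aestronglyMeasurable]
    exact integral_congr_ae hae

/-- At `s = 1/e` the exponential moment of coordinate `i` is at most `exp (x i)` for every `t ≥ 0`,
because `W ≥ -1`. -/
theorem isTightMeasureSet_scaledLaw (w : ContinuumPolyaWalk P (expDiagonalLaw c) x)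
    (hx : ∀ i, 0 ≤ x i) (hx0 : x ≠ 0) :
    IsTightMeasureSet {(w.scaledLaw hx hx0 t : Measure (Fin c → ℝ≥0)) | t ∈ Set.Ici (0 : ℝ)} := by
  refine isTightMeasureSet_of_lintegral_exp_le (Real.exp_pos (-1))
    (C := fun i => ENNReal.ofReal (Real.exp (x i))) (fun i => ENNReal.ofReal_ne_top) ?_
  rintro _ ⟨t, ht, rfl⟩ i
  obtain ⟨h1, h2⟩ := w.integrable_and_integral_scaledLaw hx hx0 i ht le_rfl
  rw [← ofReal_integral_eq_lintegral_ofReal h1 (ae_of_all _ fun _ => (Real.exp_pos _).le), h2,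
    (w.integrable_and_integral_exp_scaled hx hx0 i ht le_rfl).2]
  refine ENNReal.ofReal_le_ofReal (Real.exp_le_exp.mpr ?_)
  have h3 := neg_one_le_lambertW
    (neg_le_neg (scaled_arg_le (t := t) (le_refl (Real.exp (-1)))))
  nlinarith [hx i]

/-- The law is obtained from the walk itself: by tightness the rescaled laws at integer times have a
limit point, whose coordinate `i` has the required transform. -/
theorem exists_isLambert (w : ContinuumPolyaWalk P (expDiagonalLaw c) x)
    (hx : ∀ i, 0 ≤ x i) (hx0 : x ≠ 0) (i : Fin c) :
    ∃ μ : Measure ℝ, IsProbabilityMeasure μ ∧ IsLambert id μ (x i) := by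
  let L : ℕ → ProbabilityMeasure (Fin c → ℝ≥0) := fun n => w.scaledLaw hx hx0 n
  have hcomp : IsCompact (closure (Set.range L)) := by
    refine isCompact_closure_of_isTightMeasureSet
      ((w.isTightMeasureSet_scaledLaw hx hx0).subset ?_)
    rintro _ ⟨_, ⟨n, rfl⟩, rfl⟩
    exact ⟨n, Set.mem_Ici.mpr n.cast_nonneg, rfl⟩
  -- An ultrafilter finer than `atTop` converges in the compact closure, which replaces the
  -- extraction of a subsequence.
  obtain ⟨μ₀, -, hμ₀⟩ := hcomp.ultrafilter_le_nhds ((hyperfilter ℕ).map L)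
    (le_principal_iff.mpr (mem_of_superset (Filter.range_mem_map) subset_closure))
  have hlim : Tendsto L (hyperfilter ℕ : Filter ℕ) (𝓝 μ₀) := hμ₀
  have hnat : Tendsto (fun n : ℕ => (n : ℝ)) (hyperfilter ℕ : Filter ℕ) atTop :=
    tendsto_natCast_atTop_atTop.mono_left Nat.hyperfilter_le_atTop
  have key := fun s (hs : s ≤ Real.exp (-1)) => integrable_and_integral_exp_of_tendsto hlim
    (y := fun y : Fin c → ℝ≥0 => (y i : ℝ)) (by fun_prop) (fun y => (y i).coe_nonneg)
    (Real.exp_pos (-1)) (L := fun s => Real.exp (x i * treeFunction s))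
    (fun n s hs => (w.integrable_and_integral_scaledLaw hx hx0 i n.cast_nonneg hs).1)
    (fun s hs => by
      simp only [L, (w.integrable_and_integral_scaledLaw hx hx0 i (Nat.cast_nonneg _) hs).2]
      exact (w.tendsto_integral_exp_scaled hx hx0 i hs).comp hnat)
    (((continuousOn_treeFunction _ Set.self_mem_Iic).mono Set.Iio_subset_Iic_self).const_mul
      (x i) |>.rexp) hs
  have hm : Measurable fun y : Fin c → ℝ≥0 => (y i : ℝ) := by fun_prop
  refine ⟨(μ₀ : Measure (Fin c → ℝ≥0)).map fun y => (y i : ℝ),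
    Measure.isProbabilityMeasure_map hm.aemeasurable, aemeasurable_id, fun s hs hs0 => ?_⟩
  have hexp : Measurable fun z : ℝ => Real.exp (s * id z) := by fun_prop
  rw [treeFunction_div_rpow hs hs0, mgf, integrable_map_measure hexp.aestronglyMeasurable
    hm.aemeasurable, integral_map hm.aemeasurable hexp.aestronglyMeasurable]
  exact key s hs

theorem tendsto_integral_expNegSum_scaledLaw (w : ContinuumPolyaWalk P (expDiagonalLaw c) x)
    (hx : ∀ i, 0 ≤ x i) (hx0 : x ≠ 0) (k : Fin c → ℕ) :
    Tendsto (fun t => ∫ y, expNegSum k y ∂(w.scaledLaw hx hx0 t : Measure (Fin c → ℝ≥0))) atTop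
      (𝓝 (Real.exp (∑ i, x i * treeFunction (-(k i : ℝ))))) := by
  refine (w.tendsto_integral_exp_sum_scaled hx hx0 (s := fun i => -(k i : ℝ))
    fun i => neg_nonpos.mpr (k i).cast_nonneg).congr fun t => ?_
  simp only [scaledLaw, ProbabilityMeasure.coe_mk]
  rw [integral_map (w.aemeasurable_scaled hx hx0 t)
    (expNegSum k).continuous.aestronglyMeasurable]
  refine integral_congr_ae ?_
  filter_upwards [w.ae_coe_scaled hx hx0 t] with ω hω
  rw [expNegSum_apply]
  simp only [hω, neg_mul, Finset.sum_neg_distrib]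

theorem tendstoInDistribution_scaled (w : ContinuumPolyaWalk P (expDiagonalLaw c) x)
    (hx : ∀ i, 0 ≤ x i) (hx0 : x ≠ 0) {Ω' : Type*} [MeasurableSpace Ω'] {P' : Measure Ω'}
    [IsProbabilityMeasure P'] {W : Fin c → Ω' → ℝ} (hW : ∀ i, IsLambert (W i) P' (x i))
    (hind : iIndepFun W P') :
    TendstoInDistribution w.scaled atTop (fun ω' i => (W i ω').toNNReal) (fun _ => P) P' where
  forall_aemeasurable := w.aemeasurable_scaled hx hx0
  aemeasurable_limit := aemeasurable_pi_iff.mpr fun i => (hW i).1.real_toNNReal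
  tendsto := by
    have hWm : AEMeasurable (fun ω' i => (W i ω').toNNReal) P' :=
      aemeasurable_pi_iff.mpr fun i => (hW i).1.real_toNNReal
    -- Tightness is known for `t ≥ 0` only, hence `max t 0`, which equals `t` eventually.
    have htight : IsTightMeasureSet
        {(w.scaledLaw hx hx0 (max t 0) : Measure (Fin c → ℝ≥0)) | t : ℝ} :=
      (w.isTightMeasureSet_scaledLaw hx hx0).subset (by
        rintro _ ⟨t, rfl⟩
        exact ⟨max t 0, Set.mem_Ici.mpr (le_max_right _ _), rfl⟩)
    have hmax : (fun t : ℝ => max t 0) =ᶠ[atTop] id := by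
      filter_upwards [eventually_ge_atTop 0] with t ht using max_eq_left ht
    refine Tendsto.congr' (f₁ := fun t => w.scaledLaw hx hx0 (max t 0)) ?_
      (tendsto_of_tight_of_tendsto_laplace htight fun k => ?_)
    · filter_upwards [hmax] with t ht
      rw [ht]
      rfl
    · refine Tendsto.congr' ?_ ?_ (f₁ := fun t => ∫ y, expNegSum k y
        ∂(w.scaledLaw hx hx0 t : Measure (Fin c → ℝ≥0)))
      · filter_upwards [hmax] with t ht
        rw [ht]
        rfl
      · have hlim : ∫ y, expNegSum k y ∂(P'.map fun ω' i => (W i ω').toNNReal) =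
            Real.exp (∑ i, x i * treeFunction (-(k i : ℝ))) := by
          rw [integral_map hWm (expNegSum k).continuous.aestronglyMeasurable,
            ← integral_exp_sum_of_isLambert hW hind fun i =>
              (neg_nonpos.mpr (k i).cast_nonneg).trans (Real.exp_pos (-1)).le]
          refine integral_congr_ae ?_
          filter_upwards [ae_all_iff.mpr fun i => (hW i).ae_nonneg (hx i)] with ω hω
          rw [expNegSum_apply]
          simp only [Real.coe_toNNReal _ (hω _), neg_mul, Finset.sum_neg_distrib]
        simp only [ProbabilityMeasure.coe_mk]
        rw [hlim]
        exact w.tendsto_integral_expNegSum_scaledLaw hx hx0 k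

end ContinuumPolyaWalk

theorem mainTheorem7 {Ω Ω' : Type*} [MeasurableSpace Ω] [MeasurableSpace Ω']
    (P : Measure Ω) [IsProbabilityMeasure P] {c : ℕ} (x : Fin c → ℝ)
    (hx : ∀ i, 0 ≤ x i) (hx0 : x ≠ 0) (w : ContinuumPolyaWalk P (expDiagonalLaw c) x) :
    (∀ (i : Fin c) (t u : ℝ), 0 ≤ t → u < 1 → u * Real.exp (t - u) ≤ Real.exp (-1) →
      Integrable (fun ω => Real.exp (u * w.X t ω i)) P ∧
      mgf (fun ω => w.X t ω i) P u =
        Real.exp (-(x i * lambertW (-(u * Real.exp (t - u)))))) ∧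
    (∀ (i : Fin c) (s : ℝ), s ≤ Real.exp (-1) → s ≠ 0 →
      Tendsto (fun t : ℝ => mgf (fun ω => Real.exp (-t) * w.X t ω i) P s) atTop
        (𝓝 ((treeFunction s / s) ^ x i))) ∧
    (∀ i : Fin c, ∃ μ : Measure ℝ, IsProbabilityMeasure μ ∧ IsLambert id μ (x i)) ∧
    (∀ (P' : Measure Ω') [IsProbabilityMeasure P'] (W : Fin c → Ω' → ℝ),
      (∀ i, IsLambert (W i) P' (x i)) → iIndepFun W P' →
        TendstoInDistribution (fun (t : ℝ) ω => Real.exp (-t) • w.X t ω) atTop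
          (fun ω' i => W i ω') (fun _ => P) P') := by
  refine ⟨fun i t u ht hu h => w.integrable_and_mgf_X hx hx0 i ht hu h, fun i s hs hs0 => ?_,
    w.exists_isLambert hx hx0, fun P' _ W hW hind => ?_⟩
  · rw [treeFunction_div_rpow hs hs0]
    exact w.tendsto_integral_exp_scaled hx hx0 i hs
  -- The inclusion of the orthant carries the convergence back to real vectors; positive parts
  -- change nothing almost surely.
  · have hc : Continuous fun (y : Fin c → NNReal) i => (y i : ℝ) := by fun_prop
    refine ((w.tendstoInDistribution_scaled hx hx0 hW hind).continuous_comp hc).congr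
      (fun t => ?_) ?_
    · filter_upwards [w.ae_coe_scaled hx hx0 t] with ω hω
      ext i
      exact hω i
    · filter_upwards [ae_all_iff.mpr fun i => (hW i).ae_nonneg (hx i)] with ω hω
      ext i
      exact Real.coe_toNNReal _ (hω i)
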